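/- Let $T_d$ be the Chebyshev polynomial of the first kind of degree $d$ (so $T_d(\cos\theta)=\cos d\theta$), and let $F_d=F_d^{B_2}\in\mathbb R[x,y]$ be the folding polynomials of the root system $B_2$, defined recursively by $F_0=1$, $F_1=\frac14y$, $F_2=\frac14y^2-\frac12(x^2-2y-4)-1$, $F_3=\frac14y^3-\frac34y(x^2-2y-4)-\frac34y$ and $$F_d=y\,(F_{d-1}+F_{d-3})-\bigl(2+(x^2-2y-4)\bigr)F_{d-2}-F_{d-4}\qquad(d\ge4).$$ For $n\ge 2$ consider in $\mathbb P^n(\mathbb C)$ the projective closures of the affine hypersurfaces $$\mathrm{TChm}^n_d:\ \sum_{i=0}^{n-1}T_d(x_i)=-(n\bmod 2),\qquad \mathrm{Chm}^n_\varepsilon(F_d):\ \sum_{i=0}^{\lfloor (n-2)/2\rfloor}\varepsilon_i\,F_d(x_{2i},x_{2i+1})=-(n\bmod 2)\cdot\tfrac12\bigl(T_d(x_{n-1})+1\bigr),$$ where the signs are either alternating, $\varepsilon_i=(-1)^i$ (the hypersurface $\mathrm{Chm}^n_{\mathrm{alt}}$), or all equal to $1$ (the hypersurface $\mathrm{Chm}^n_{+}$).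 Let $\mu$ denote the number of nodes ($A_1$-singularities) of a hypersurface in $\mathbb P^n(\mathbb C)$. **Proposition.** Let $n\ge2$ and $d\ge3$. These hypersurfaces have only finitely many nodes, and the better of the two hypersurfaces built from $F_d$ has strictly more nodes than $\mathrm{TChm}^n_d$: $$\max\bigl(\mu(\mathrm{Chm}^n_{\mathrm{alt}}(F_d)),\,\mu(\mathrm{Chm}^n_{+}(F_d))\bigr)>\mu(\mathrm{TChm}^n_d).$$ More precisely, $\mu(\mathrm{Chm}^n_{\mathrm{alt}}(F_d))>\mu(\mathrm{TChm}^n_d)$ whenever $n$ is even or $d$ is odd, and $\mu(\mathrm{Chm}^n_{+}(F_d))>\mu(\mathrm{TChm}^n_d)$ whenever $d$ is even. -/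

import Mathlib

open scoped LinearAlgebra.Projectivization

namespace NodalHypersurface

open MvPolynomial

/-- The homogenization of `f`, in the homogeneous coordinates `X 0, X 1, …, X n` of `ℙⁿ`:
the affine coordinate `X i` becomes `X i.succ`, and `X 0` is the new coordinate.
Its zero set in `ℙⁿ` is the projective closure of the affine hypersurface `f = 0`. -/
noncomputable def homogenize {n : ℕ} (f : MvPolynomial (Fin n) ℂ) :
    MvPolynomial (Fin (n + 1)) ℂ :=
  ∑ m ∈ f.support,
    monomial (Finsupp.cons (f.totalDegree - m.degree) m) (f.coeff m)

/-- The Hessian matrix of `G` at `v`. -/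
noncomputable def hessianAt {n : ℕ} (G : MvPolynomial (Fin (n + 1)) ℂ) (v : Fin (n + 1) → ℂ) :
    Matrix (Fin (n + 1)) (Fin (n + 1)) ℂ :=
  Matrix.of fun i j => eval v (pderiv i (pderiv j G))

/-- The point of `ℙⁿ` with homogeneous coordinates `v` is a node (an ordinary double point, type
`A₁`) of the hypersurface `G = 0`, where `G` is homogeneous: it is a singular point of the
hypersurface, and the quadratic form of second derivatives is nondegenerate there.
At a singular point the Hessian matrix of the homogeneous form `G` kills `v`, and it induces on the
`n`-dimensional quotient by the line `ℂ v` (the tangent space of `ℙⁿ`, up to a twist) the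
Hessian of a local affine equation; so the latter is nondegenerate exactly when the matrix has
rank `n`. -/
def IsNodeAt {n : ℕ} (G : MvPolynomial (Fin (n + 1)) ℂ) (v : Fin (n + 1) → ℂ) : Prop :=
  eval v G = 0 ∧ (∀ i, eval v (pderiv i G) = 0) ∧ (hessianAt G v).rank = n

/-- The nodes in complex projective space `ℙⁿ` of the projective hypersurface with affine
equation `f = 0`. (The condition does not depend on the representative, since the
homogenization is homogeneous.) -/
def nodes {n : ℕ} (f : MvPolynomial (Fin n) ℂ) : Set (ℙ ℂ (Fin (n + 1) → ℂ)) :=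
  {p | IsNodeAt (homogenize f) p.rep}

/-- The number `μ` of nodes of the projective hypersurface with affine equation `f = 0`. -/
noncomputable def nodeCount {n : ℕ} (f : MvPolynomial (Fin n) ℂ) : ℕ := (nodes f).ncard

/-- The folding polynomials `F_d` of the root system `B₂`, with `x = X 0` and `y = X 1`. -/
noncomputable def foldB2 : ℕ → MvPolynomial (Fin 2) ℂ
  | 0 => 1
  | 1 => C (1 / 4) * X 1
  | 2 => C (1 / 4) * X 1 ^ 2 - C (1 / 2) * (X 0 ^ 2 - 2 * X 1 - 4) - 1
  | 3 => C (1 / 4) * X 1 ^ 3 - C (3 / 4) * X 1 * (X 0 ^ 2 - 2 * X 1 - 4) - C (3 / 4) * X 1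
  | d + 4 => X 1 * (foldB2 (d + 3) + foldB2 (d + 1))
      - (2 + (X 0 ^ 2 - 2 * X 1 - 4)) * foldB2 (d + 2) - foldB2 d

/-- The Chebyshev polynomial `T_d` (of the first kind) in the variable `X i`. -/
noncomputable def chebT {n : ℕ} (d : ℕ) (i : Fin n) : MvPolynomial (Fin n) ℂ :=
  Polynomial.aeval (X i) (Polynomial.Chebyshev.T ℂ (d : ℤ))

/-- The equation (left-hand side minus right-hand side) of
`TChm : ∑_{i < n} T_d(x_i) = -(n mod 2)`. -/
noncomputable def tchm (n d : ℕ) : MvPolynomial (Fin n) ℂ :=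
  (∑ i : Fin n, chebT d i) + ((n % 2 : ℕ) : MvPolynomial (Fin n) ℂ)

/-- The equation (left-hand side minus right-hand side) of the hypersurface
`∑_{i < ⌊n/2⌋} ε_i F_d(x_{2i}, x_{2i+1}) = -(n mod 2) * (T_d(x_{n-1}) + 1) / 2`
built from the `B₂` folding polynomial `F_d`, with signs `ε_i`. -/
noncomputable def chmB2 (ε : ℕ → ℤ) (n d : ℕ) : MvPolynomial (Fin n) ℂ :=
  (∑ i : Fin (n / 2), (ε i : MvPolynomial (Fin n) ℂ) *
      aeval ![X ⟨2 * i, by omega⟩, X ⟨2 * i + 1, by omega⟩] (foldB2 d))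
    + if h : n % 2 = 1 then C (1 / 2) * (chebT d ⟨n - 1, by omega⟩ + 1) else 0

/-- Chm with alternating signs `ε_i = (-1)^i`. -/
noncomputable def chmB2Alt (n d : ℕ) : MvPolynomial (Fin n) ℂ := chmB2 (fun i => (-1) ^ i) n d

/-- Chm with the signs `(-1)^i` replaced by `1`. -/
noncomputable def chmB2Plain (n d : ℕ) : MvPolynomial (Fin n) ℂ := chmB2 (fun _ => 1) n d

end NodalHypersurface

/-!
Nodes are counted as nondegenerate affine critical points with critical value `0`. All the
hypersurfaces are smooth at infinity, because their leading forms are sums, in separate variables,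
of multiples of `x ^ d` and of the leading form of `F_d`, which becomes `(u^{2d} + v^{2d}) / 4` for
`x = u v`, `y = u² + v²`; so every singular point is affine
(`nodes_subset_image_affinePoint`), and its coordinates are made up of critical points of `T_d` and
of `F_d`, which gives finiteness.

In the coordinates `x = 2 (p + q)`, `y = 4 p q` the folding polynomial is `T_d(p) T_d(q)`
(`aeval_foldB2`). Hence unordered pairs `{p, q}` of distinct roots of `T_d`, respectively of
distinct critical points of `T_d`, give nondegenerate critical points of `F_d` with value `0`,
respectively `±1` (`spec_of_mem_foldCrit`). If `T_d` has `e` critical points with value `1` and `o`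
with value `-1`, their numbers are `N₀ = d (d - 1) / 2`, `N₊ = (e (e - 1) + o (o - 1)) / 2` and
`N₋ = e o`. A pair of variables of `TChm` contributes instead the half sums of two critical values,
with multiplicities `2 e o`, `e²`, `o²` for the values `0`, `1`, `-1`.

The number of tuples of critical points whose values add up to zero is the average of the product of
the generating functions `Q(z) = N₀ + N₊ z + N₋ z⁻¹` over a sufficiently large group of roots of
unity, or over its multiple by any radius. Choosing the radius well, the average for `TChm` is, up to
the factor of an unpaired variable, the one of `(e o (2 + W)) ^ m` with `W = z + z⁻¹`
(`natCast_mul_nodeCount_tchm_le_sum`).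
* For alternating signs the product is a power of `|Q|²`, times `Q` if the number of pairs is odd, and
  `re Q ≥ e o (2 + W)` on the unit circle (`nodeCount_tchm_lt_chmB2Alt`).
* For equal signs and even `d`, put `r = √(o / e)`. On the circle of radius `r` the function `Q`
  becomes `e o (1 + r² + W / r)`, which is larger than `e o (2 + W)`. If there is an unpaired variable,
  one has to compare the averages of `(2 + W / r) (1 + r² + W / r) ^ m` and `(2 + W) ^ (m + 1)`; here
  integration by parts shows that the former increases with `r ≥ 1`
  (`strictMonoOn_sum_two_add_div`, `nodeCount_tchm_lt_chmB2Plain`).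
-/

namespace NodalHypersurface

open MvPolynomial

/-! ### Affine charts of the homogenization -/

section Homogenization

/-- The chain rule for a derivation and a polynomial substitution. -/
theorem derivation_aeval {R σ A : Type*} [CommRing R] [Fintype σ] [CommRing A] [Algebra R A]
    (D : Derivation R A A) (g : σ → A) (F : MvPolynomial σ R) :
    D (aeval g F) = ∑ s, aeval g (pderiv s F) * D (g s) := by
  classical
  induction F using MvPolynomial.induction_on with
  | C a => simp [← algebraMap_eq]
  | add p q hp hq => simp [hp, hq, add_mul, Finset.sum_add_distrib]
  | mul_X p i hp =>
    simp only [map_mul, aeval_X, Derivation.leibniz, smul_eq_mul, hp, pderiv_X, map_add, add_mul,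
      Finset.sum_add_distrib, Finset.mul_sum]
    congr 1
    · rw [Finset.sum_eq_single i (fun s _ hs => by simp [hs.symm]) (by simp)]
      simp
    · exact Finset.sum_congr rfl fun s _ => by ring

variable {n : ℕ}

/-- Evaluation on the slice `X 0 = c` factors through the substitution `X 0 = c`. -/
theorem eval_cons (G : MvPolynomial (Fin (n + 1)) ℂ) (c : ℂ) (x : Fin n → ℂ) :
    eval (Fin.cons c x) G = eval x (aeval (Fin.cons (C c) X) G) := by
  induction G using MvPolynomial.induction_on with
  | C a => simp
  | add p q hp hq => simp [hp, hq]
  | mul_X p i hp =>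
    rw [map_mul, map_mul, map_mul, hp]
    refine Fin.cases ?_ (fun j => ?_) i <;> simp

theorem pderiv_aeval_cons (G : MvPolynomial (Fin (n + 1)) ℂ) (c : ℂ) (i : Fin n) :
    pderiv i (aeval (Fin.cons (C c) X : Fin (n + 1) → MvPolynomial (Fin n) ℂ) G) =
      aeval (Fin.cons (C c) X) (pderiv i.succ G) := by
  classical
  rw [derivation_aeval, Fin.sum_univ_succ]
  simp [pderiv_X, Pi.single_apply]

theorem isHomogeneous_homogenize (f : MvPolynomial (Fin n) ℂ) :
    (homogenize f).IsHomogeneous f.totalDegree := by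
  refine IsHomogeneous.sum _ _ _ fun m hm => isHomogeneous_monomial _ ?_
  have h1 : m.degree ≤ f.totalDegree := le_totalDegree hm
  rw [Finsupp.degree_eq_sum, Fin.sum_univ_succ]
  simp only [Finsupp.cons_zero, Finsupp.cons_succ]
  rw [← Finsupp.degree_eq_sum]
  omega

theorem aeval_cons_monomial (c : ℂ) (a : ℕ) (m : Fin n →₀ ℕ) (r : ℂ) :
    aeval (Fin.cons (C c) X : Fin (n + 1) → MvPolynomial (Fin n) ℂ)
      (monomial (Finsupp.cons a m) r) = monomial m (r * c ^ a) := by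
  rw [aeval_monomial, Finsupp.prod_fintype _ _ (by simp), Fin.prod_univ_succ]
  simp only [Finsupp.cons_zero, Finsupp.cons_succ, Fin.cons_zero, Fin.cons_succ]
  rw [monomial_eq, Finsupp.prod_fintype _ _ (by simp), algebraMap_eq, C_mul, C_pow, mul_assoc]

/-- Setting `X 0 = 1` recovers the affine equation. -/
theorem aeval_cons_one_homogenize (f : MvPolynomial (Fin n) ℂ) :
    aeval (Fin.cons (C 1) X : Fin (n + 1) → MvPolynomial (Fin n) ℂ) (homogenize f) = f := by
  rw [homogenize, map_sum]
  simp only [aeval_cons_monomial, one_pow, mul_one]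
  exact f.support_sum_monomial_coeff

/-- Setting `X 0 = 0` gives the leading form. -/
theorem aeval_cons_zero_homogenize (f : MvPolynomial (Fin n) ℂ) :
    aeval (Fin.cons (C 0) X : Fin (n + 1) → MvPolynomial (Fin n) ℂ) (homogenize f) =
      homogeneousComponent f.totalDegree f := by
  rw [homogenize, map_sum, homogeneousComponent_apply, Finset.sum_filter]
  refine Finset.sum_congr rfl fun m hm => ?_
  have h1 : m.degree ≤ f.totalDegree := le_totalDegree hm
  rw [aeval_cons_monomial]
  split_ifs with h
  · simp [h]
  · rw [zero_pow (by omega), mul_zero, monomial_zero]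

/-- `x` is a singular point of the affine hypersurface `f = 0`. -/
def IsSingularAt (f : MvPolynomial (Fin n) ℂ) (x : Fin n → ℂ) : Prop :=
  eval x f = 0 ∧ ∀ i, eval x (pderiv i f) = 0

/-- The point of `ℙⁿ` given by the point `x` of the affine chart `X 0 ≠ 0`. -/
noncomputable def affinePoint (x : Fin n → ℂ) : ℙ ℂ (Fin (n + 1) → ℂ) :=
  .mk ℂ (Fin.cons 1 x) fun h => one_ne_zero (α := ℂ) (by simpa using congrFun h 0)

theorem affinePoint_injective : Function.Injective (affinePoint (n := n)) := by
  intro x y h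
  obtain ⟨a, ha⟩ := (Projectivization.mk_eq_mk_iff' ℂ _ _ _ _).1 h
  have h0 := congrFun ha 0
  simp only [Pi.smul_apply, Fin.cons_zero, smul_eq_mul, mul_one] at h0
  subst h0
  funext i
  simpa using (congrFun ha i.succ).symm

/-- The leading form of `f` has no critical point besides the origin, so that the projective
closure of `f = 0` has no singular point at infinity. -/
def SmoothAtInfinity (f : MvPolynomial (Fin n) ℂ) : Prop :=
  ∀ x, (∀ i, eval x (pderiv i (homogeneousComponent f.totalDegree f)) = 0) → x = 0

theorem eval_smul_of_isHomogeneous {σ : Type*} {G : MvPolynomial σ ℂ} {D : ℕ}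
    (hG : G.IsHomogeneous D) (c : ℂ) (v : σ → ℂ) : eval (c • v) G = c ^ D * eval v G := by
  rw [eval_eq, eval_eq, Finset.mul_sum]
  refine Finset.sum_congr rfl fun m hm => ?_
  have h1 : ∑ i ∈ m.support, m i = D := by
    exact (hG.degree_eq_sum_deg_support hm).symm
  simp only [Pi.smul_apply, smul_eq_mul, mul_pow, Finset.prod_mul_distrib]
  rw [Finset.prod_pow_eq_pow_sum, h1]
  ring

theorem nodes_subset_image_affinePoint {f : MvPolynomial (Fin n) ℂ} (hf : SmoothAtInfinity f) :
    nodes f ⊆ affinePoint '' {x | IsSingularAt f x} := by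
  intro p hp
  obtain ⟨h0, h1, -⟩ := hp
  set v := p.rep with hv
  have hvne : v ≠ 0 := p.rep_nonzero
  have hhom := isHomogeneous_homogenize f
  have hv0 : v 0 ≠ 0 := by
    intro h
    apply hvne
    have hcons : v = Fin.cons 0 (Fin.tail v) := by rw [← h, Fin.cons_self_tail]
    have ht : Fin.tail v = 0 := hf _ fun i => by
      rw [← aeval_cons_zero_homogenize, pderiv_aeval_cons, ← eval_cons, ← hcons]
      exact h1 _
    rw [hcons, ht]
    funext i
    refine Fin.cases ?_ (fun j => ?_) i <;> simp
  set x : Fin n → ℂ := fun i => (v 0)⁻¹ * v i.succ with hx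
  have hcons : (Fin.cons 1 x : Fin (n + 1) → ℂ) = (v 0)⁻¹ • v := by
    funext i
    refine Fin.cases ?_ (fun j => ?_) i <;> simp [hx, hv0]
  refine ⟨x, ⟨?_, fun i => ?_⟩, ?_⟩
  · rw [← aeval_cons_one_homogenize f, ← eval_cons, hcons, eval_smul_of_isHomogeneous hhom, h0,
      mul_zero]
  · rw [← aeval_cons_one_homogenize f, pderiv_aeval_cons, ← eval_cons, hcons,
      eval_smul_of_isHomogeneous hhom.pderiv, h1, mul_zero]
  · rw [← p.mk_rep, affinePoint, Projectivization.mk_eq_mk_iff']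
    exact ⟨_, hcons.symm⟩

theorem isNodeAt_smul {G : MvPolynomial (Fin (n + 1)) ℂ} {D : ℕ} (hG : G.IsHomogeneous D)
    {v : Fin (n + 1) → ℂ} {c : ℂ} (hc : c ≠ 0) (h : IsNodeAt G v) : IsNodeAt G (c • v) := by
  obtain ⟨h0, h1, h2⟩ := h
  refine ⟨by rw [eval_smul_of_isHomogeneous hG, h0, mul_zero],
    fun i => by rw [eval_smul_of_isHomogeneous hG.pderiv, h1, mul_zero], ?_⟩
  have : hessianAt G (c • v) = c ^ (D - 1 - 1) • hessianAt G v := by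
    ext i j
    simp [hessianAt, eval_smul_of_isHomogeneous hG.pderiv.pderiv]
  rw [this, Matrix.rank_smul_of_mem_nonZeroDivisors _
    (mem_nonZeroDivisors_of_ne_zero (pow_ne_zero _ hc)), h2]

/-- A singular point of the affine hypersurface with nondegenerate affine Hessian is a node. The
homogeneous Hessian `H` has rank at least `n` because it contains the affine one as a block, and
rank at most `n` because it kills the vector of homogeneous coordinates, by Euler's identity. -/
theorem affinePoint_mem_nodes {f : MvPolynomial (Fin n) ℂ} {x : Fin n → ℂ}
    (hx : IsSingularAt f x)
    (hH : ∀ u : Fin n → ℂ, (∀ i, ∑ j, eval x (pderiv i (pderiv j f)) * u j = 0) → u = 0) :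
    affinePoint x ∈ nodes f := by
  obtain ⟨a, ha⟩ := Projectivization.exists_smul_eq_mk_rep ℂ (Fin.cons 1 x : Fin (n + 1) → ℂ)
    fun h => one_ne_zero (α := ℂ) (by simpa using congrFun h 0)
  change IsNodeAt _ (Projectivization.rep _)
  rw [affinePoint, ← ha]
  set G := homogenize f with hGdef
  have hG : G.IsHomogeneous f.totalDegree := isHomogeneous_homogenize f
  refine isNodeAt_smul hG a.ne_zero ?_
  set v : Fin (n + 1) → ℂ := Fin.cons 1 x with hv
  have e0 : eval v G = 0 := by
    rw [hv, eval_cons, hGdef, aeval_cons_one_homogenize, hx.1]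
  have esucc (i : Fin n) : eval v (pderiv i.succ G) = 0 := by
    rw [hv, eval_cons, ← pderiv_aeval_cons, hGdef, aeval_cons_one_homogenize, hx.2]
  have ezero : eval v (pderiv 0 G) = 0 := by
    have := congrArg (eval v) hG.sum_X_mul_pderiv
    rw [map_sum, Fin.sum_univ_succ] at this
    simp only [map_mul, eval_X, esucc, mul_zero, Finset.sum_const_zero, add_zero, map_nsmul, e0,
      smul_zero] at this
    simpa [hv] using this
  have eall (i) : eval v (pderiv i G) = 0 := Fin.cases ezero esucc i
  refine ⟨e0, eall, ?_⟩
  have hvne : v ≠ 0 := fun h => one_ne_zero (α := ℂ) (by simpa [hv] using congrFun h 0)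
  have hker : Matrix.vecMul v (hessianAt G v) = 0 := by
    funext j
    have := congrArg (eval v) (hG.pderiv (i := j)).sum_X_mul_pderiv
    simp only [map_sum, map_mul, eval_X, map_nsmul, eall, smul_zero] at this
    exact this
  apply le_antisymm
  · have h1 := Matrix.rank_add_rank_le_card_of_mul_eq_zero
      (A := Matrix.replicateRow Unit v) (B := hessianAt G v) (by
        ext i j
        exact congrFun hker j)
    have h2 : 1 ≤ (Matrix.replicateRow Unit v).rank := by
      have h3 : LinearIndependent ℂ (Matrix.replicateRow Unit v).row :=
        linearIndependent_unique_iff.2 hvne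
      rw [h3.rank_matrix, Fintype.card_unit]
    simp only [Fintype.card_fin] at h1
    omega
  · have h1 : ((hessianAt G v).submatrix Fin.succ Fin.succ).det ≠ 0 := by
      intro h
      obtain ⟨u, hu, hu0⟩ := Matrix.exists_mulVec_eq_zero_iff.2 h
      refine hu (hH u fun i => ?_)
      rw [← Pi.zero_apply (M := fun _ => ℂ) i, ← hu0]
      refine Finset.sum_congr rfl fun j _ => ?_
      change _ = hessianAt G v i.succ j.succ * u j
      rw [hessianAt, Matrix.of_apply, hv, eval_cons, ← pderiv_aeval_cons,
        ← pderiv_aeval_cons, hGdef, aeval_cons_one_homogenize]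
    have h2 := Matrix.rank_of_det_ne_zero h1
    have h3 := Matrix.rank_submatrix_le (hessianAt G v) Fin.succ Fin.succ
    rw [h2, Fintype.card_fin] at h3
    exact h3

end Homogenization

/-! ### Critical points of Chebyshev polynomials -/

section Chebyshev

open Polynomial (derivative)
open Polynomial.Chebyshev (T U)

theorem chebyshev_pell (d : ℕ) (x : ℂ) :
    (T ℂ d).eval x ^ 2 + (1 - x ^ 2) * (U ℂ (d - 1)).eval x ^ 2 = 1 := by
  obtain ⟨θ, rfl⟩ := Complex.cos_surjective x
  have h1 := Polynomial.Chebyshev.T_complex_cos θ d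
  have h2 := Polynomial.Chebyshev.U_complex_cos θ (d - 1)
  have h3 := Complex.sin_sq_add_cos_sq θ
  have h4 := Complex.sin_sq_add_cos_sq (d * θ)
  rw [Int.cast_sub, Int.cast_one, sub_add_cancel, Int.cast_natCast] at h2
  rw [h1, Int.cast_natCast]
  rw [← h2] at h4
  linear_combination h4 - (U ℂ (d - 1)).eval (Complex.cos θ) ^ 2 * h3

theorem eval_derivative_T (d : ℕ) (x : ℂ) :
    (derivative (T ℂ d)).eval x = d * (U ℂ (d - 1)).eval x := by
  simp [Polynomial.Chebyshev.T_derivative_eq_U]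

variable {d : ℕ}

theorem eval_T_sq_of_eval_derivative_eq_zero (hd : d ≠ 0) {x : ℂ}
    (h : (derivative (T ℂ d)).eval x = 0) : (T ℂ d).eval x ^ 2 = 1 := by
  rw [eval_derivative_T, mul_eq_zero, or_iff_right (Nat.cast_ne_zero.2 hd)] at h
  simpa [h] using chebyshev_pell d x

theorem eval_derivative_T_ne_zero (hd : d ≠ 0) {x : ℂ} (h : (T ℂ d).eval x = 0) :
    (derivative (T ℂ d)).eval x ≠ 0 := by
  intro h'
  simpa [h] using eval_T_sq_of_eval_derivative_eq_zero hd h'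

theorem eval_derivative_derivative_T_ne_zero (hd : d ≠ 0) {x : ℂ}
    (h : (derivative (T ℂ d)).eval x = 0) : (derivative (derivative (T ℂ d))).eval x ≠ 0 := by
  intro h'
  have h1 := congrArg (Polynomial.eval x)
    (Polynomial.Chebyshev.one_sub_X_sq_mul_derivative_derivative_T_eq_poly_in_T (R := ℂ) d)
  have h2 := eval_T_sq_of_eval_derivative_eq_zero hd h
  simp only [Function.iterate_succ, Function.iterate_zero, Function.comp_apply, id,
    Polynomial.eval_mul, Polynomial.eval_sub, h, h', mul_zero, zero_sub] at h1
  have h3 : (d : ℂ) ^ 2 * (T ℂ d).eval x = 0 := by simpa using h1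
  rw [mul_eq_zero, or_iff_right (pow_ne_zero 2 (Nat.cast_ne_zero.2 hd))] at h3
  simp [h3] at h2

/-- The roots of `T_d`. -/
noncomputable def chebRoots (d : ℕ) : Finset ℂ := (T ℂ d).roots.toFinset

/-- The critical points `x` of `T_d` with `(T_d(x) + 1) / 2 = v`, for `v = 0` or `v = 1`. -/
noncomputable def chebCrit (d : ℕ) (v : ℤ) : Finset ℂ :=
  {x ∈ (derivative (T ℂ d)).roots.toFinset | (T ℂ d).eval x = 2 * v - 1}

theorem mem_chebRoots {x : ℂ} : x ∈ chebRoots d ↔ (T ℂ d).eval x = 0 := by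
  simp [chebRoots, Polynomial.Chebyshev.T_ne_zero]

theorem natDegree_derivative_T (d : ℕ) : (derivative (T ℂ d)).natDegree = d - 1 := by
  rw [Polynomial.natDegree_derivative, Polynomial.Chebyshev.natDegree_T, Int.natAbs_natCast]

theorem derivative_T_ne_zero (hd : d ≠ 0) : derivative (T ℂ d) ≠ 0 := by
  intro h
  have := Polynomial.derivative_eq_zero.1 h
  rw [Polynomial.Chebyshev.natDegree_T, Int.natAbs_natCast] at this
  exact hd this

theorem mem_chebCrit (hd : d ≠ 0) {v : ℤ} {x : ℂ} :
    x ∈ chebCrit d v ↔ (derivative (T ℂ d)).eval x = 0 ∧ (T ℂ d).eval x = 2 * v - 1 := by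
  simp [chebCrit, derivative_T_ne_zero hd]

theorem card_chebRoots (hd : d ≠ 0) : (chebRoots d).card = d := by
  have hsep : (T ℂ d).Separable := by
    rw [Polynomial.separable_def,
      Polynomial.isCoprime_iff_aeval_ne_zero_of_isAlgClosed ℂ ℂ]
    intro x
    simp only [Polynomial.coe_aeval_eq_eval]
    by_cases h : (T ℂ d).eval x = 0
    · exact Or.inr (eval_derivative_T_ne_zero hd h)
    · exact Or.inl h
  rw [chebRoots, Multiset.toFinset_card_of_nodup (Polynomial.nodup_roots hsep),
    ← (IsAlgClosed.splits (T ℂ d)).natDegree_eq_card_roots, Polynomial.Chebyshev.natDegree_T,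
    Int.natAbs_natCast]

theorem cos_mem_chebCrit {k : ℕ} (hk : 0 < k) (hkd : k < d) {v : ℤ}
    (hv : (-1 : ℝ) ^ k = 2 * v - 1) :
    ((Real.cos (k * Real.pi / d) : ℝ) : ℂ) ∈ chebCrit d v := by
  have hd : d ≠ 0 := by omega
  have hd' : (d : ℝ) ≠ 0 := Nat.cast_ne_zero.2 hd
  have hdpos : (0 : ℝ) < d := by positivity
  have hmul : ((d : ℤ) : ℝ) * (k * Real.pi / d) = k * Real.pi := by
    push_cast; field_simp
  rw [mem_chebCrit hd]
  constructor
  · have h1 := Polynomial.Chebyshev.U_real_cos (k * Real.pi / d) (d - 1)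
    rw [Int.cast_sub, Int.cast_one, sub_add_cancel, hmul, Real.sin_nat_mul_pi, mul_eq_zero,
      or_iff_left] at h1
    · rw [eval_derivative_T, ← Polynomial.Chebyshev.complex_ofReal_eval_U, h1]
      simp
    · refine (Real.sin_pos_of_pos_of_lt_pi (by positivity) ?_).ne'
      rw [div_lt_iff₀ hdpos, mul_comm]
      exact mul_lt_mul_of_pos_left (by exact_mod_cast hkd) Real.pi_pos
  · have h1 := Polynomial.Chebyshev.T_real_cos (k * Real.pi / d) d
    rw [hmul, Real.cos_nat_mul_pi, hv] at h1
    rw [← Polynomial.Chebyshev.complex_ofReal_eval_T, h1]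
    push_cast; ring

theorem cos_div_injOn (d : ℕ) :
    Set.InjOn (fun k : ℕ => ((Real.cos (k * Real.pi / d) : ℝ) : ℂ)) {k | k < d} := by
  intro k hk l hl h
  have hd : (0 : ℝ) < d := by
    have : 0 < d := lt_of_le_of_lt (Nat.zero_le k) hk
    exact_mod_cast this
  have hmem (j : ℕ) (hj : j < d) : (j * Real.pi / d : ℝ) ∈ Set.Icc 0 Real.pi := by
    refine ⟨by positivity, ?_⟩
    rw [div_le_iff₀ hd, mul_comm]
    exact mul_le_mul_of_nonneg_left (by exact_mod_cast hj.le) Real.pi_pos.le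
  have h1 := Real.injOn_cos (hmem k hk) (hmem l hl) (Complex.ofReal_injective h)
  field_simp at h1
  exact_mod_cast h1

theorem disjoint_chebCrit (d : ℕ) : Disjoint (chebCrit d 0) (chebCrit d 1) := by
  rw [Finset.disjoint_left]
  intro x h0 h1
  have e0 := (Finset.mem_filter.1 h0).2
  have e1 := (Finset.mem_filter.1 h1).2
  rw [e0] at e1
  norm_num at e1

/-- The critical points `cos (k π / d)` of `T_d` have the value `(-1) ^ k`, and there are no others
because `T_d'` has degree `d - 1`. -/
theorem card_chebCrit (d : ℕ) :
    (chebCrit d 0).card = d / 2 ∧ (chebCrit d 1).card = (d - 1) / 2 := by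
  have h0 : d / 2 ≤ (chebCrit d 0).card := by
    rw [← Finset.card_range (d / 2)]
    refine Finset.card_le_card_of_injOn
      (fun j => ((Real.cos (((2 * j + 1 : ℕ) : ℝ) * Real.pi / d) : ℝ) : ℂ)) ?_ ?_
    · intro j hj
      have := Finset.mem_range.1 hj
      exact cos_mem_chebCrit (by omega) (by omega) (by rw [pow_succ, pow_mul]; norm_num)
    · intro i hi j hj h
      have h1 := Finset.mem_range.1 hi
      have h2 := Finset.mem_range.1 hj
      have := cos_div_injOn d (show 2 * i + 1 < d by omega) (show 2 * j + 1 < d by omega) h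
      omega
  have h1 : (d - 1) / 2 ≤ (chebCrit d 1).card := by
    rw [← Finset.card_range ((d - 1) / 2)]
    refine Finset.card_le_card_of_injOn
      (fun j => ((Real.cos (((2 * j + 2 : ℕ) : ℝ) * Real.pi / d) : ℝ) : ℂ)) ?_ ?_
    · intro j hj
      have := Finset.mem_range.1 hj
      exact cos_mem_chebCrit (by omega) (by omega) (by rw [pow_add, pow_mul]; norm_num)
    · intro i hi j hj h
      have h1 := Finset.mem_range.1 hi
      have h2 := Finset.mem_range.1 hj
      have := cos_div_injOn d (show 2 * i + 2 < d by omega) (show 2 * j + 2 < d by omega) h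
      omega
  have h2 : (chebCrit d 0).card + (chebCrit d 1).card ≤ d - 1 := by
    rw [← Finset.card_union_of_disjoint (disjoint_chebCrit d), ← natDegree_derivative_T d]
    refine le_trans (Finset.card_le_card (t := (derivative (T ℂ d)).roots.toFinset) ?_) ?_
    · exact Finset.union_subset (Finset.filter_subset _ _) (Finset.filter_subset _ _)
    · exact le_trans (Multiset.toFinset_card_le _) (Polynomial.card_roots' _)
  omega

end Chebyshev

/-! ### The folding polynomials of `B₂` -/

section Folding

open Polynomial (derivative)
open Polynomial.Chebyshev (T)

theorem foldB2_add_four (d : ℕ) : foldB2 (d + 4) = X 1 * (foldB2 (d + 3) + foldB2 (d + 1))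
      - (2 + (X 0 ^ 2 - 2 * X 1 - 4)) * foldB2 (d + 2) - foldB2 d := by
  rw [foldB2]

/-- The folding polynomial is `T_d(p) T_d(q)` in the coordinates `x = 2 (p + q)`, `y = 4 p q`. -/
theorem aeval_foldB2 {A : Type*} [CommRing A] [Algebra ℂ A] (p q : A) : ∀ d : ℕ,
    aeval ![2 * (p + q), 4 * p * q] (foldB2 d) = (T A d).eval p * (T A d).eval q
  | 0 => by simp [foldB2]
  | 1 => by
    have h : algebraMap ℂ A (1 / 4) * 4 = 1 := by
      rw [← map_ofNat (algebraMap ℂ A) 4, ← map_mul]; norm_num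
    simp only [foldB2, map_mul, algHom_C, aeval_X, Matrix.cons_val_one, Nat.cast_one,
      Polynomial.Chebyshev.T_one, Polynomial.eval_X, Matrix.cons_val_fin_one]
    linear_combination p * q * h
  | 2 => by
    have h : algebraMap ℂ A (1 / 4) * 4 = 1 := by
      rw [← map_ofNat (algebraMap ℂ A) 4, ← map_mul]; norm_num
    have h2 : algebraMap ℂ A (1 / 2) * 2 = 1 := by
      rw [← map_ofNat (algebraMap ℂ A) 2, ← map_mul]; norm_num
    simp only [foldB2, map_mul, algHom_C, aeval_X, Matrix.cons_val_one, Matrix.cons_val_zero,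
      Nat.cast_ofNat, Polynomial.Chebyshev.T_two, Polynomial.eval_X, Matrix.cons_val_fin_one,
      map_sub, map_pow, map_ofNat, map_one, Polynomial.eval_sub, Polynomial.eval_mul,
      Polynomial.eval_pow, Polynomial.eval_one, Polynomial.eval_ofNat]
    linear_combination 4 * p ^ 2 * q ^ 2 * h - (2 * (p + q) ^ 2 - 4 * p * q - 2) * h2
  | 3 => by
    have h : algebraMap ℂ A (1 / 4) * 4 = 1 := by
      rw [← map_ofNat (algebraMap ℂ A) 4, ← map_mul]; norm_num
    have h2 : algebraMap ℂ A (3 / 4) * 4 = 3 := by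
      rw [← map_ofNat (algebraMap ℂ A) 4, ← map_mul, ← map_ofNat (algebraMap ℂ A) 3]; norm_num
    have h3 : T A 3 = 4 * Polynomial.X ^ 3 - 3 * Polynomial.X := by
      rw [show (3 : ℤ) = 1 + 2 by norm_num, Polynomial.Chebyshev.T_add_two,
        show (1 : ℤ) + 1 = 2 by norm_num, Polynomial.Chebyshev.T_two,
        Polynomial.Chebyshev.T_one]
      ring
    simp only [foldB2, map_mul, algHom_C, aeval_X, Matrix.cons_val_one, Matrix.cons_val_zero,
      Nat.cast_ofNat, h3, Polynomial.eval_X, Matrix.cons_val_fin_one,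
      map_sub, map_pow, map_ofNat, Polynomial.eval_sub, Polynomial.eval_mul,
      Polynomial.eval_pow, Polynomial.eval_ofNat]
    linear_combination 16 * p ^ 3 * q ^ 3 * h
      - (p * q * (4 * (p + q) ^ 2 - 8 * p * q - 4) + p * q) * h2
  | d + 4 => by
    have h (e : ℕ) (x : A) : (T A ((e + 2 : ℕ) : ℤ)).eval x =
        2 * x * (T A ((e + 1 : ℕ) : ℤ)).eval x - (T A (e : ℤ)).eval x := by
      push_cast
      rw [Polynomial.Chebyshev.T_add_two]
      simp
    simp only [foldB2_add_four, map_sub, map_mul, map_add, aeval_foldB2 p q (d + 3),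
      aeval_foldB2 p q (d + 2), aeval_foldB2 p q (d + 1), aeval_foldB2 p q d, aeval_X, map_pow,
      map_ofNat, Matrix.cons_val_one, Matrix.cons_val_zero, Matrix.cons_val_fin_one]
    rw [h (d + 2) p, h (d + 2) q, h (d + 1) p, h (d + 1) q, h d p, h d q]
    ring

/-- The leading form of `foldB2 d`; for `d = 0` the convention is the one of the recursion. -/
noncomputable def foldTop : ℕ → MvPolynomial (Fin 2) ℂ
  | 0 => C (1 / 2)
  | 1 => C (1 / 4) * X 1
  | d + 2 => X 1 * foldTop (d + 1) - X 0 ^ 2 * foldTop d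

theorem aeval_foldTop {A : Type*} [CommRing A] [Algebra ℂ A] (u v : A) : ∀ d : ℕ,
    aeval ![u * v, u ^ 2 + v ^ 2] (foldTop d) =
      algebraMap ℂ A (1 / 4) * (u ^ (2 * d) + v ^ (2 * d))
  | 0 => by
    have : algebraMap ℂ A (1 / 2) = algebraMap ℂ A (1 / 4) * 2 := by
      rw [← map_ofNat (algebraMap ℂ A) 2, ← map_mul]; norm_num
    simp only [foldTop, algHom_C, this]
    ring
  | 1 => by
    simp only [foldTop, map_mul, algHom_C, aeval_X, Matrix.cons_val_one, Matrix.cons_val_fin_one]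
  | d + 2 => by
    simp only [foldTop, map_mul, map_sub, map_pow, aeval_X, Matrix.cons_val_one,
      Matrix.cons_val_zero, Matrix.cons_val_fin_one, aeval_foldTop u v d,
      aeval_foldTop u v (d + 1)]
    ring

theorem isHomogeneous_foldTop : ∀ d, (foldTop d).IsHomogeneous d
  | 0 => isHomogeneous_C _ _
  | 1 => isHomogeneous_C_mul_X _ _
  | d + 2 => by
    refine IsHomogeneous.sub ?_ ?_
    · have := (isHomogeneous_X ℂ (1 : Fin 2)).mul (isHomogeneous_foldTop (d + 1))
      rwa [show 1 + (d + 1) = d + 2 by ring] at this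
    · have := (isHomogeneous_X_pow (R := ℂ) (0 : Fin 2) 2).mul (isHomogeneous_foldTop d)
      rwa [show 2 + d = d + 2 by ring] at this

section Degree

variable {σ : Type*} {f g : MvPolynomial σ ℂ} {a b k : ℕ}

theorem totalDegree_add_le_of_le (hf : f.totalDegree ≤ k) (hg : g.totalDegree ≤ k) :
    (f + g).totalDegree ≤ k :=
  (totalDegree_add f g).trans (max_le hf hg)

theorem totalDegree_sub_le_of_le (hf : f.totalDegree ≤ k) (hg : g.totalDegree ≤ k) :
    (f - g).totalDegree ≤ k :=
  (totalDegree_sub f g).trans (max_le hf hg)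

theorem totalDegree_mul_le_of_le (hf : f.totalDegree ≤ a) (hg : g.totalDegree ≤ b)
    (h : a + b ≤ k) : (f * g).totalDegree ≤ k :=
  (totalDegree_mul f g).trans ((add_le_add hf hg).trans h)

end Degree

theorem totalDegree_foldB2_of_sub {d k : ℕ}
    (h : (foldB2 d - foldTop d).totalDegree ≤ k) (hk : k ≤ d) : (foldB2 d).totalDegree ≤ d := by
  rw [← sub_add_cancel (foldB2 d) (foldTop d)]
  exact totalDegree_add_le_of_le (h.trans hk) (isHomogeneous_foldTop d).totalDegree_le

theorem totalDegree_foldB2_zero : (foldB2 0).totalDegree ≤ 0 := by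
  simp [foldB2]

theorem totalDegree_foldB2_sub_foldTop (d : ℕ) :
    (foldB2 (d + 1) - foldTop (d + 1)).totalDegree ≤ d := by
  have hX (i : Fin 2) : (X i : MvPolynomial (Fin 2) ℂ).totalDegree ≤ 1 := (totalDegree_X i).le
  have hC (c : ℂ) (k : ℕ) : (C c : MvPolynomial (Fin 2) ℂ).totalDegree ≤ k := by simp
  induction d using Nat.strong_induction_on with
  | _ d ih =>
    match d with
    | 0 => simp [foldB2, foldTop]
    | 1 =>
      have h : foldB2 2 - foldTop 2 = X 1 + C 1 := by
        have h2 : (C (1 / 2) : MvPolynomial (Fin 2) ℂ) * 2 = 1 := by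
          rw [← map_ofNat C 2, ← C_mul]; norm_num
        rw [C_1]
        simp only [foldB2, foldTop]
        linear_combination (X 1 + 2) * h2
      rw [h]
      exact totalDegree_add_le_of_le (hX 1) (hC _ _)
    | 2 =>
      have h : foldB2 3 - foldTop 3 = C (3 / 2) * X 1 * X 1 + C (9 / 4) * X 1 := by
        have h1 : (C (3 / 4) : MvPolynomial (Fin 2) ℂ) = C (1 / 4) * 3 := by
          rw [← map_ofNat C 3, ← C_mul]; norm_num
        have h2 : (C (1 / 2) : MvPolynomial (Fin 2) ℂ) = C (1 / 4) * 2 := by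
          rw [← map_ofNat C 2, ← C_mul]; norm_num
        have h3 : (C (3 / 2) : MvPolynomial (Fin 2) ℂ) = C (1 / 4) * 6 := by
          rw [← map_ofNat C 6, ← C_mul]; norm_num
        have h4 : (C (9 / 4) : MvPolynomial (Fin 2) ℂ) = C (1 / 4) * 9 := by
          rw [← map_ofNat C 9, ← C_mul]; norm_num
        simp only [foldB2, foldTop, h1, h2, h3, h4]
        ring
      rw [h]
      refine totalDegree_add_le_of_le ?_ (totalDegree_mul_le_of_le (hC _ 0) (hX 1) (by norm_num))
      exact totalDegree_mul_le_of_le (totalDegree_mul_le_of_le (hC _ 0) (hX 1) le_rfl) (hX 1)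
        (by norm_num)
    | d + 3 =>
      have hlow : (foldB2 d).totalDegree ≤ d := by
        match d, ih with
        | 0, _ => exact totalDegree_foldB2_zero
        | e + 1, ih => exact totalDegree_foldB2_of_sub (ih e (by omega)) (by omega)
      have h1 := totalDegree_foldB2_of_sub (ih d (by omega)) (by omega)
      have h2 := totalDegree_foldB2_of_sub (ih (d + 1) (by omega)) (by omega)
      have e2 := ih (d + 1) (by omega)
      have e3 := ih (d + 2) (by omega)
      have h : foldB2 (d + 3 + 1) - foldTop (d + 3 + 1) =
          X 1 * (foldB2 (d + 2 + 1) - foldTop (d + 2 + 1)) + X 1 * foldB2 (d + 1)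
          - X 0 * X 0 * (foldB2 (d + 1 + 1) - foldTop (d + 1 + 1))
          + (X 1 + X 1 + C 2) * foldB2 (d + 1 + 1) - foldB2 d := by
        rw [foldB2_add_four, show foldTop (d + 3 + 1) = X 1 * foldTop (d + 3) -
          X 0 ^ 2 * foldTop (d + 2) from by rw [foldTop], map_ofNat C 2]
        ring
      rw [h]
      refine totalDegree_sub_le_of_le (totalDegree_add_le_of_le (totalDegree_sub_le_of_le
        (totalDegree_add_le_of_le ?_ ?_) ?_) ?_) (by omega)
      · exact totalDegree_mul_le_of_le (hX 1) e3 (by omega)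
      · exact totalDegree_mul_le_of_le (hX 1) h1 (by omega)
      · exact totalDegree_mul_le_of_le (totalDegree_mul_le_of_le (hX 0) (hX 0) le_rfl) e2
          (by omega)
      · exact totalDegree_mul_le_of_le (a := 1) (totalDegree_add_le_of_le
          (totalDegree_add_le_of_le (hX 1) (hX 1)) (hC _ _)) h2 (by omega)

/-- The substitution `x = u v`, `y = u² + v²` turns the leading form into `(u^{2d} + v^{2d}) / 4`,
whose only critical point is the origin. -/
theorem eq_zero_of_pderiv_foldTop_eq_zero {d : ℕ} (hd : d ≠ 0) {z : Fin 2 → ℂ}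
    (hz : ∀ i, eval z (pderiv i (foldTop d)) = 0) : z = 0 := by
  -- `u = (s + t) / 2` and `v = (s - t) / 2` satisfy `u v = z 0` and `u² + v² = z 1`.
  obtain ⟨s, hs⟩ := IsAlgClosed.exists_pow_nat_eq (z 1 + 2 * z 0) two_pos
  obtain ⟨t, ht⟩ := IsAlgClosed.exists_pow_nat_eq (z 1 - 2 * z 0) two_pos
  have hzero (i j : Fin 2) (w : Fin 2 → ℂ) (hw0 : w 0 * w 1 = z 0)
      (hw1 : w 0 ^ 2 + w 1 ^ 2 = z 1) : w i = 0 := by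
    have key := congrArg (fun P => eval w (pderiv i P))
      (aeval_foldTop (X 0 : MvPolynomial (Fin 2) ℂ) (X 1) d)
    have hcomp (P : MvPolynomial (Fin 2) ℂ) : eval w (aeval
        ![(X 0 * X 1 : MvPolynomial (Fin 2) ℂ), X 0 ^ 2 + X 1 ^ 2] P) = eval z P := by
      rw [← coe_aeval_eq_eval, ← coe_aeval_eq_eval, RingHom.coe_coe, RingHom.coe_coe,
        ← AlgHom.comp_apply]
      congr 1
      ext k
      fin_cases k <;> simp [hw0, hw1]
    simp only [derivation_aeval, Fin.sum_univ_two, map_add, map_mul, hcomp, hz, zero_mul,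
      add_zero] at key
    fin_cases i
    · simp [algebraMap_eq, hd, pderiv_X] at key
      exact key.1
    · simp [algebraMap_eq, hd, pderiv_X] at key
      exact key.1
  have hw0 : ((s + t) / 2) * ((s - t) / 2) = z 0 := by linear_combination (hs - ht) / 4
  have hw1 : ((s + t) / 2) ^ 2 + ((s - t) / 2) ^ 2 = z 1 := by linear_combination (hs + ht) / 2
  have h0 : (s + t) / 2 = 0 := hzero 0 0 ![(s + t) / 2, (s - t) / 2] hw0 hw1
  have h1 : (s - t) / 2 = 0 := hzero 1 0 ![(s + t) / 2, (s - t) / 2] hw0 hw1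
  funext i
  fin_cases i
  · simp [← hw0, h0]
  · simp [← hw1, h0, h1]

theorem pderiv_comm {σ : Type*} (i j : σ) (P : MvPolynomial σ ℂ) :
    pderiv i (pderiv j P) = pderiv j (pderiv i P) := by
  classical
  have h : ⁅pderiv (R := ℂ) i, pderiv (R := ℂ) j⁆ = 0 := by
    refine derivation_ext fun k => ?_
    simp only [Derivation.commutator_apply, pderiv_X, Derivation.coe_zero, Pi.zero_apply]
    rw [Pi.single_apply, Pi.single_apply]
    split_ifs <;> simp
  have := DFunLike.congr_fun h P
  rwa [Derivation.commutator_apply, Derivation.coe_zero, Pi.zero_apply, sub_eq_zero] at this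

/-- The folding coordinates `x = 2 (p + q)`, `y = 4 p q` of the pair `(p, q)`. -/
def foldMap (p : ℂ × ℂ) : ℂ × ℂ := (2 * (p.1 + p.2), 4 * p.1 * p.2)

theorem foldMap_surjective : Function.Surjective foldMap := by
  intro z
  obtain ⟨s, hs⟩ := IsAlgClosed.exists_pow_nat_eq (z.1 ^ 2 - 4 * z.2) two_pos
  refine ⟨((z.1 + s) / 4, (z.1 - s) / 4), Prod.ext ?_ ?_⟩
  · simp only [foldMap]; ring
  · simp only [foldMap]; linear_combination - hs / 4

theorem foldMap_eq_iff {p q : ℂ × ℂ} : foldMap p = foldMap q ↔ p = q ∨ p = q.swap := by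
  constructor
  · intro h
    have h1 : p.1 + p.2 = q.1 + q.2 := by
      have := congrArg Prod.fst h
      simpa [foldMap] using this
    have h2 : 4 * p.1 * p.2 = 4 * q.1 * q.2 := congrArg Prod.snd h
    have h3 : (p.1 - q.1) * (p.1 - q.2) = 0 := by linear_combination p.1 * h1 - h2 / 4
    rcases mul_eq_zero.1 h3 with h4 | h4
    · exact Or.inl (Prod.ext (by linear_combination h4) (by linear_combination h1 - h4))
    · exact Or.inr (Prod.ext (by simpa [sub_eq_zero] using h4)
        (by simp only [Prod.snd_swap]; linear_combination h1 - h4))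
  · rintro (rfl | rfl)
    · rfl
    · simp only [foldMap, Prod.fst_swap, Prod.snd_swap, Prod.mk.injEq]
      constructor <;> ring

/-- The Chebyshev description of gradient and Hessian of the folding polynomial in the folding
coordinates. -/
theorem foldB2_derivatives (d : ℕ) (p : ℂ × ℂ) :
    let z := ![(foldMap p).1, (foldMap p).2]
    let F₀ := eval z (pderiv 0 (foldB2 d))
    let F₁ := eval z (pderiv 1 (foldB2 d))
    let F₀₀ := eval z (pderiv 0 (pderiv 0 (foldB2 d)))
    let F₀₁ := eval z (pderiv 0 (pderiv 1 (foldB2 d)))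
    let F₁₁ := eval z (pderiv 1 (pderiv 1 (foldB2 d)))
    let t := fun k => (derivative^[k] (T ℂ d)).eval
    eval z (foldB2 d) = t 0 p.1 * t 0 p.2 ∧
    2 * F₀ + 4 * p.2 * F₁ = t 1 p.1 * t 0 p.2 ∧
    2 * F₀ + 4 * p.1 * F₁ = t 0 p.1 * t 1 p.2 ∧
    4 * F₀₀ + 16 * p.2 * F₀₁ + 16 * p.2 ^ 2 * F₁₁ = t 2 p.1 * t 0 p.2 ∧
    4 * F₀₀ + 8 * (p.1 + p.2) * F₀₁ + 16 * p.1 * p.2 * F₁₁ + 4 * F₁ = t 1 p.1 * t 1 p.2 ∧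
    4 * F₀₀ + 16 * p.1 * F₀₁ + 16 * p.1 ^ 2 * F₁₁ = t 0 p.1 * t 2 p.2 := by
  intro z F₀ F₁ F₀₀ F₀₁ F₁₁ t
  set φ : MvPolynomial (Fin 2) ℂ →ₐ[ℂ] MvPolynomial (Fin 2) ℂ :=
    aeval ![2 * (X 0 + X 1), 4 * X 0 * X 1] with hφ
  set w : Fin 2 → ℂ := ![p.1, p.2] with hw
  have hcomp (P : MvPolynomial (Fin 2) ℂ) : eval w (φ P) = eval z P := by
    rw [← coe_aeval_eq_eval, ← coe_aeval_eq_eval, RingHom.coe_coe, RingHom.coe_coe,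
      ← AlgHom.comp_apply]
    congr 1
    ext k
    fin_cases k <;> simp [hw, hφ, z, foldMap]
  have hT (P : Polynomial ℂ) (i : Fin 2) :
      eval w (Polynomial.aeval (X i : MvPolynomial (Fin 2) ℂ) P) = P.eval (w i) := by
    rw [← coe_aeval_eq_eval, RingHom.coe_coe, ← Polynomial.aeval_algHom_apply]
    simp
  have hD (i : Fin 2) (P : MvPolynomial (Fin 2) ℂ) : pderiv i (φ P) =
      φ (pderiv 0 P) * pderiv i (2 * (X 0 + X 1)) + φ (pderiv 1 P) * pderiv i (4 * X 0 * X 1) := by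
    rw [hφ, derivation_aeval, Fin.sum_univ_two]
    simp
  have h20 (i : Fin 2) : pderiv i (2 : MvPolynomial (Fin 2) ℂ) = 0 := by
    rw [← map_ofNat C 2, pderiv_C]
  have h40 (i : Fin 2) : pderiv i (4 : MvPolynomial (Fin 2) ℂ) = 0 := by
    rw [← map_ofNat C 4, pderiv_C]
  have hx0 : pderiv 0 (2 * (X 0 + X 1) : MvPolynomial (Fin 2) ℂ) = 2 := by
    simp [pderiv_X, h20]
  have hx1 : pderiv 1 (2 * (X 0 + X 1) : MvPolynomial (Fin 2) ℂ) = 2 := by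
    simp [pderiv_X, h20]
  have hy0 : pderiv 0 (4 * X 0 * X 1 : MvPolynomial (Fin 2) ℂ) = 4 * X 1 := by
    simp [pderiv_X, h40, mul_comm]
  have hy1 : pderiv 1 (4 * X 0 * X 1 : MvPolynomial (Fin 2) ℂ) = 4 * X 0 := by
    simp [pderiv_X, h40]
  have key : φ (foldB2 d) = Polynomial.aeval (X 0) (T ℂ d) * Polynomial.aeval (X 1) (T ℂ d) := by
    rw [hφ, aeval_foldB2, Polynomial.Chebyshev.aeval_T, Polynomial.Chebyshev.aeval_T]
  have k0 := congrArg (pderiv 0) key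
  have k1 := congrArg (pderiv 1) key
  rw [hD, hx0, hy0, pderiv_mul, Derivation.map_aeval, Derivation.map_aeval, pderiv_X_self,
    pderiv_X_of_ne (by decide)] at k0
  rw [hD, hx1, hy1, pderiv_mul, Derivation.map_aeval, Derivation.map_aeval, pderiv_X_self,
    pderiv_X_of_ne (by decide)] at k1
  simp only [smul_eq_mul, mul_one, mul_zero, zero_mul, add_zero, zero_add] at k0 k1
  have k00 := congrArg (pderiv 0) k0
  have k01 := congrArg (pderiv 1) k0
  have k11 := congrArg (pderiv 1) k1
  simp only [map_add, pderiv_mul, hD, hx0, hx1, hy0, hy1, h20, h40, Derivation.map_aeval,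
    pderiv_X_self, pderiv_X_of_ne (show (1 : Fin 2) ≠ 0 by decide),
    pderiv_X_of_ne (show (0 : Fin 2) ≠ 1 by decide), smul_eq_mul, mul_one, mul_zero, zero_mul,
    add_zero, zero_add] at k00 k01 k11
  have e := congrArg (eval w) key
  have e0 := congrArg (eval w) k0
  have e1 := congrArg (eval w) k1
  have e00 := congrArg (eval w) k00
  have e01 := congrArg (eval w) k01
  have e11 := congrArg (eval w) k11
  simp only [map_add, map_mul, hcomp, hT, map_ofNat, eval_X] at e e0 e1 e00 e01 e11
  rw [pderiv_comm 1 0] at e01 e11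
  have w0 : w 0 = p.1 := rfl
  have w1 : w 1 = p.2 := rfl
  rw [w0, w1] at e e0 e1 e00 e01 e11
  refine ⟨e, ?_, ?_, ?_, ?_, ?_⟩
  · simp only [t, F₀, F₁, Function.iterate_succ, Function.iterate_zero, Function.comp_apply, id]
    linear_combination e0
  · simp only [t, F₀, F₁, Function.iterate_succ, Function.iterate_zero, Function.comp_apply, id]
    linear_combination e1
  · simp only [t, F₀₀, F₀₁, F₁₁, Function.iterate_succ, Function.iterate_zero,
      Function.comp_apply, id]
    rw [pderiv_comm 1 0] at e00
    linear_combination e00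
  · simp only [t, F₀₀, F₀₁, F₁₁, F₁, Function.iterate_succ, Function.iterate_zero,
      Function.comp_apply, id]
    linear_combination e01
  · simp only [t, F₀₀, F₀₁, F₁₁, Function.iterate_succ, Function.iterate_zero,
      Function.comp_apply, id]
    linear_combination e11

/-- The point `z = (x, y)` is a critical point of the folding polynomial. -/
def IsFoldCritical (d : ℕ) (z : ℂ × ℂ) : Prop :=
  eval ![z.1, z.2] (pderiv 0 (foldB2 d)) = 0 ∧ eval ![z.1, z.2] (pderiv 1 (foldB2 d)) = 0

theorem finite_isFoldCritical {d : ℕ} (hd : d ≠ 0) : {z | IsFoldCritical d z}.Finite := by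
  have hfin : ((chebRoots d ∪ (derivative (T ℂ d)).roots.toFinset : Finset ℂ) : Set ℂ).Finite :=
    Finset.finite_toSet _
  refine ((hfin.prod hfin).image foldMap).subset fun z hz => ?_
  obtain ⟨p, rfl⟩ := foldMap_surjective z
  refine ⟨p, ?_, rfl⟩
  obtain ⟨-, h0, h1, -⟩ := foldB2_derivatives d p
  obtain ⟨hz0, hz1⟩ := hz
  simp only [hz0, hz1, mul_zero, add_zero, Function.iterate_succ, Function.iterate_zero,
    Function.comp_apply, id] at h0 h1
  simp only [Finset.coe_union, Set.mem_prod, Set.mem_union, Finset.mem_coe, mem_chebRoots,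
    Multiset.mem_toFinset, Polynomial.mem_roots (derivative_T_ne_zero hd), Polynomial.IsRoot]
  have n1 := eval_derivative_T_ne_zero hd (x := p.1)
  have n2 := eval_derivative_T_ne_zero hd (x := p.2)
  rcases mul_eq_zero.1 h0.symm with h | h <;> rcases mul_eq_zero.1 h1.symm with h' | h' <;> tauto

/-- The ordered pairs `(p, q)` of distinct Chebyshev points that fold to critical points of
`foldB2 d` with value `v`: for `v = 0` both are roots of `T_d`; for `v = 1` and `v = -1` both are
critical points of `T_d`, with equal or opposite values. Any other `v`
is treated as `-1`. -/
noncomputable def foldPairs (d : ℕ) (v : ℤ) : Finset (ℂ × ℂ) :=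
  if v = 0 then (chebRoots d).offDiag
  else if v = 1 then (chebCrit d 0).offDiag ∪ (chebCrit d 1).offDiag
  else (chebCrit d 0 ×ˢ chebCrit d 1) ∪ (chebCrit d 1 ×ˢ chebCrit d 0)

/-- The critical points of `foldB2 d` with value `v`, for `v = 0, 1, -1`. -/
noncomputable def foldCrit (d : ℕ) (v : ℤ) : Finset (ℂ × ℂ) := (foldPairs d v).image foldMap

theorem fst_ne_snd_of_mem_foldPairs {d : ℕ} {v : ℤ} {p : ℂ × ℂ} (hp : p ∈ foldPairs d v) :
    p.1 ≠ p.2 := by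
  have hdis := Finset.disjoint_left.1 (disjoint_chebCrit d)
  unfold foldPairs at hp
  split_ifs at hp
  · exact (Finset.mem_offDiag.1 hp).2.2
  · rcases Finset.mem_union.1 hp with h | h <;> exact (Finset.mem_offDiag.1 h).2.2
  · rcases Finset.mem_union.1 hp with h | h <;> rw [Finset.mem_product] at h <;>
      intro he <;> rw [he] at h
    · exact hdis h.1 h.2
    · exact hdis h.2 h.1

theorem swap_mem_foldPairs {d : ℕ} {v : ℤ} {p : ℂ × ℂ} (hp : p ∈ foldPairs d v) :
    p.swap ∈ foldPairs d v := by
  unfold foldPairs at hp ⊢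
  split_ifs at hp ⊢ <;>
    simp only [Finset.mem_offDiag, Finset.mem_union, Finset.mem_product, Prod.fst_swap,
      Prod.snd_swap, ne_comm] at hp ⊢ <;> tauto

theorem two_mul_card_foldCrit (d : ℕ) (v : ℤ) :
    2 * (foldCrit d v).card = (foldPairs d v).card := by
  rw [Finset.card_eq_sum_card_fiberwise (f := foldMap) (t := foldCrit d v)
    fun p hp => Finset.mem_coe.2 (Finset.mem_image_of_mem _ hp), Finset.sum_const_nat (m := 2),
    mul_comm]
  intro z hz
  obtain ⟨p, hp, rfl⟩ := Finset.mem_image.1 hz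
  have : {q ∈ foldPairs d v | foldMap q = foldMap p} = {p, p.swap} := by
    ext q
    simp only [Finset.mem_filter, foldMap_eq_iff, Finset.mem_insert, Finset.mem_singleton]
    constructor
    · exact fun h => h.2
    · rintro (rfl | rfl)
      · exact ⟨hp, Or.inl rfl⟩
      · exact ⟨swap_mem_foldPairs hp, Or.inr rfl⟩
  rw [this, Finset.card_pair]
  intro h
  exact fst_ne_snd_of_mem_foldPairs hp (congrArg Prod.fst h)

theorem card_foldCrit_zero {d : ℕ} (hd : d ≠ 0) : 2 * (foldCrit d 0).card = d * (d - 1) := by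
  rw [two_mul_card_foldCrit, foldPairs, if_pos rfl, Finset.offDiag_card, card_chebRoots hd,
    Nat.mul_sub_one]

theorem card_foldCrit_one (d : ℕ) : 2 * (foldCrit d 1).card =
    d / 2 * (d / 2 - 1) + (d - 1) / 2 * ((d - 1) / 2 - 1) := by
  rw [two_mul_card_foldCrit, foldPairs, if_neg one_ne_zero, if_pos rfl,
    Finset.card_union_of_disjoint, Finset.offDiag_card, Finset.offDiag_card, (card_chebCrit d).1,
    (card_chebCrit d).2, Nat.mul_sub_one, Nat.mul_sub_one]
  rw [Finset.disjoint_left]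
  intro p h0 h1
  exact Finset.disjoint_left.1 (disjoint_chebCrit d) (Finset.mem_offDiag.1 h0).1
    (Finset.mem_offDiag.1 h1).1

theorem card_foldCrit_neg_one (d : ℕ) : (foldCrit d (-1)).card = d / 2 * ((d - 1) / 2) := by
  have h : 2 * (foldCrit d (-1)).card = 2 * (d / 2 * ((d - 1) / 2)) := by
    rw [two_mul_card_foldCrit, foldPairs, if_neg (by decide), if_neg (by decide),
      Finset.card_union_of_disjoint, Finset.card_product, Finset.card_product,
      (card_chebCrit d).1, (card_chebCrit d).2]
    · ring
    rw [Finset.disjoint_left]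
    intro p h0 h1
    exact Finset.disjoint_left.1 (disjoint_chebCrit d) (Finset.mem_product.1 h0).1
      (Finset.mem_product.1 h1).1
  omega

/-- The points of `foldCrit d v` are nondegenerate critical points with value `v`. -/
theorem spec_of_mem_foldCrit {d : ℕ} (hd : d ≠ 0) {v : ℤ} (hv : v = 0 ∨ v = 1 ∨ v = -1)
    {z : ℂ × ℂ} (hz : z ∈ foldCrit d v) :
    eval ![z.1, z.2] (foldB2 d) = v ∧ IsFoldCritical d z ∧
    eval ![z.1, z.2] (pderiv 0 (pderiv 0 (foldB2 d))) *
      eval ![z.1, z.2] (pderiv 1 (pderiv 1 (foldB2 d))) -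
      eval ![z.1, z.2] (pderiv 0 (pderiv 1 (foldB2 d))) ^ 2 ≠ 0 := by
  obtain ⟨p, hp, rfl⟩ := Finset.mem_image.1 hz
  have hne := sub_ne_zero.2 (fst_ne_snd_of_mem_foldPairs hp)
  obtain ⟨h, h0, h1, h00, h01, h11⟩ := foldB2_derivatives d p
  simp only [Function.iterate_succ, Function.iterate_zero, Function.comp_apply, id]
    at h h0 h1 h00 h01 h11
  -- The values of `T_d`, `T_d'` and `T_d''` at the two points that the argument uses.
  have hcases : (T ℂ d).eval p.1 * (T ℂ d).eval p.2 = v ∧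
      (derivative (T ℂ d)).eval p.1 * (T ℂ d).eval p.2 = 0 ∧
      (T ℂ d).eval p.1 * (derivative (T ℂ d)).eval p.2 = 0 ∧
      ((derivative (derivative (T ℂ d))).eval p.1 * (T ℂ d).eval p.2) *
        ((T ℂ d).eval p.1 * (derivative (derivative (T ℂ d))).eval p.2) -
        ((derivative (T ℂ d)).eval p.1 * (derivative (T ℂ d)).eval p.2) ^ 2 ≠ 0 := by
    have hcrit {a b : ℤ} (ha : p.1 ∈ chebCrit d a) (hb : p.2 ∈ chebCrit d b)
        (hab : (2 * a - 1) * (2 * b - 1) = v) : (T ℂ d).eval p.1 * (T ℂ d).eval p.2 = v ∧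
      (derivative (T ℂ d)).eval p.1 * (T ℂ d).eval p.2 = 0 ∧
      (T ℂ d).eval p.1 * (derivative (T ℂ d)).eval p.2 = 0 ∧
      ((derivative (derivative (T ℂ d))).eval p.1 * (T ℂ d).eval p.2) *
        ((T ℂ d).eval p.1 * (derivative (derivative (T ℂ d))).eval p.2) -
        ((derivative (T ℂ d)).eval p.1 * (derivative (T ℂ d)).eval p.2) ^ 2 ≠ 0 := by
      rw [mem_chebCrit hd] at ha hb
      have sa := eval_T_sq_of_eval_derivative_eq_zero hd ha.1
      have sb := eval_T_sq_of_eval_derivative_eq_zero hd hb.1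
      have ta : (T ℂ d).eval p.1 ≠ 0 := fun h => by simp [h] at sa
      have tb : (T ℂ d).eval p.2 ≠ 0 := fun h => by simp [h] at sb
      refine ⟨?_, by rw [ha.1, zero_mul], by rw [hb.1, mul_zero], ?_⟩
      · rw [ha.2, hb.2, ← hab]; push_cast; ring
      · rw [ha.1, zero_mul, zero_pow two_ne_zero, sub_zero]
        exact mul_ne_zero (mul_ne_zero (eval_derivative_derivative_T_ne_zero hd ha.1) tb)
          (mul_ne_zero ta (eval_derivative_derivative_T_ne_zero hd hb.1))
    unfold foldPairs at hp
    rcases hv with rfl | rfl | rfl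
    · rw [if_pos rfl, Finset.mem_offDiag, mem_chebRoots, mem_chebRoots] at hp
      refine ⟨by simp [hp.1], by rw [hp.2.1, mul_zero], by rw [hp.1, zero_mul], ?_⟩
      rw [hp.1, hp.2.1, mul_zero, zero_mul, zero_sub, neg_ne_zero]
      exact pow_ne_zero 2 (mul_ne_zero (eval_derivative_T_ne_zero hd hp.1)
        (eval_derivative_T_ne_zero hd hp.2.1))
    · rw [if_neg one_ne_zero, if_pos rfl, Finset.mem_union, Finset.mem_offDiag,
        Finset.mem_offDiag] at hp
      rcases hp with hp | hp
      · exact hcrit hp.1 hp.2.1 (by norm_num)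
      · exact hcrit hp.1 hp.2.1 (by norm_num)
    · rw [if_neg (by decide), if_neg (by decide), Finset.mem_union, Finset.mem_product,
        Finset.mem_product] at hp
      rcases hp with hp | hp
      · exact hcrit hp.1 hp.2 (by norm_num)
      · exact hcrit hp.1 hp.2 (by norm_num)
  obtain ⟨c, c0, c1, c2⟩ := hcases
  rw [c0] at h0
  rw [c1] at h1
  have hF1 : eval ![(foldMap p).1, (foldMap p).2] (pderiv 1 (foldB2 d)) = 0 :=
    (mul_eq_zero.1 (show (p.1 - p.2) * _ = 0 by linear_combination (h1 - h0) / 4)).resolve_left hne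
  have hF0 : eval ![(foldMap p).1, (foldMap p).2] (pderiv 0 (foldB2 d)) = 0 := by
    rw [hF1] at h0
    linear_combination h0 / 2
  refine ⟨h.trans c, ⟨hF0, hF1⟩, fun hdet => c2 ?_⟩
  rw [← h00, ← h11, ← h01, hF1]
  linear_combination (64 * (p.1 - p.2) ^ 2) * hdet

end Folding

/-! ### Singular points of the two kinds of hypersurfaces -/

section Singularities

open Polynomial (derivative)
open Polynomial.Chebyshev (T)

variable {n d : ℕ}

/-- Smoothness at infinity only depends on a form whose difference to `f` has lower degree. -/
theorem smoothAtInfinity_of_totalDegree_sub_lt {f g : MvPolynomial (Fin n) ℂ} {D : ℕ}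
    (hg : g.IsHomogeneous D) (h : (f - g).totalDegree < D)
    (hcrit : ∀ x, (∀ i, eval x (pderiv i g) = 0) → x = 0) : SmoothAtInfinity f := by
  intro x hx
  by_cases hg0 : g = 0
  · exact hcrit x (by simp [hg0])
  have hdeg : f.totalDegree = D := by
    rw [← sub_add_cancel f g, totalDegree_add_eq_right_of_totalDegree_lt, hg.totalDegree hg0]
    rwa [hg.totalDegree hg0]
  refine hcrit x fun i => ?_
  have : homogeneousComponent f.totalDegree f = g := by
    rw [hdeg, ← sub_add_cancel f g, map_add, homogeneousComponent_eq_zero _ _ h, zero_add,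
      homogeneousComponent_eq_self hg]
  rw [← this]
  exact hx i

theorem totalDegree_polynomial_aeval_X_le {σ : Type*} (i : σ) (P : Polynomial ℂ) :
    (Polynomial.aeval (X i : MvPolynomial σ ℂ) P).totalDegree ≤ P.natDegree := by
  rw [Polynomial.aeval_eq_sum_range]
  refine totalDegree_finsetSum_le fun k hk => ?_
  rw [smul_eq_C_mul]
  refine totalDegree_mul_le_of_le (a := 0) (b := k) (by simp) (by simp) ?_
  have := Finset.mem_range.1 hk
  omega

/-- The leading term of `T_d`. -/
noncomputable def chebTop (d : ℕ) : Polynomial ℂ :=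
  Polynomial.C (T ℂ d).leadingCoeff * Polynomial.X ^ d

theorem natDegree_T_sub_chebTop (d : ℕ) : (T ℂ d - chebTop d).natDegree ≤ d - 1 := by
  have h := Polynomial.eraseLead_natDegree_le (T ℂ d)
  rw [← Polynomial.self_sub_C_mul_X_pow] at h
  simpa [chebTop] using h

theorem eval_derivative_chebTop_eq_zero_iff (hd : 2 ≤ d) {x : ℂ} :
    (derivative (chebTop d)).eval x = 0 ↔ x = 0 := by
  have h1 : (d : ℂ) ≠ 0 := by exact_mod_cast (by omega : d ≠ 0)
  have h2 : d - 1 ≠ 0 := by omega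
  have h3 : (T ℂ d).leadingCoeff ≠ 0 :=
    Polynomial.leadingCoeff_ne_zero.2 (Polynomial.Chebyshev.T_ne_zero ℂ _)
  rw [chebTop, Polynomial.derivative_C_mul_X_pow, Polynomial.eval_C_mul, Polynomial.eval_pow,
    Polynomial.eval_X, mul_eq_zero, or_iff_right (mul_ne_zero h3 h1), pow_eq_zero_iff h2]

theorem isHomogeneous_aeval_chebTop (d : ℕ) (i : Fin n) :
    (Polynomial.aeval (X i : MvPolynomial (Fin n) ℂ) (chebTop d)).IsHomogeneous d := by
  simp only [chebTop, map_mul, Polynomial.aeval_C, map_pow, Polynomial.aeval_X, algebraMap_eq]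
  exact isHomogeneous_C_mul_X_pow _ _ _

theorem eval_aeval_X (x : Fin n → ℂ) (i : Fin n) (P : Polynomial ℂ) :
    eval x (Polynomial.aeval (X i : MvPolynomial (Fin n) ℂ) P) = P.eval (x i) := by
  rw [← coe_aeval_eq_eval, RingHom.coe_coe, ← Polynomial.aeval_algHom_apply]
  simp

theorem eval_pderiv_sum_aeval_X (x : Fin n → ℂ) (i : Fin n) (P : Polynomial ℂ) :
    eval x (pderiv i (∑ j, Polynomial.aeval (X j : MvPolynomial (Fin n) ℂ) P)) =
      (derivative P).eval (x i) := by
  rw [map_sum, map_sum, Finset.sum_eq_single i]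
  · rw [Derivation.map_aeval, pderiv_X_self, smul_eq_mul, mul_one, eval_aeval_X]
  · intro j _ hj
    rw [Derivation.map_aeval, pderiv_X_of_ne hj, smul_zero, map_zero]
  · simp

theorem smoothAtInfinity_tchm (hd : 2 ≤ d) : SmoothAtInfinity (tchm n d) := by
  refine smoothAtInfinity_of_totalDegree_sub_lt (D := d)
    (g := ∑ i, Polynomial.aeval (X i) (chebTop d))
    (IsHomogeneous.sum _ _ _ fun i _ => isHomogeneous_aeval_chebTop d i) ?_ fun x hx => ?_
  · have : tchm n d - ∑ i : Fin n, Polynomial.aeval (X i) (chebTop d) =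
        ∑ i : Fin n, Polynomial.aeval (X i) (T ℂ d - chebTop d) + C ((n % 2 : ℕ) : ℂ) := by
      simp only [tchm, chebT, map_sub, Finset.sum_sub_distrib, map_natCast C]
      ring
    rw [this]
    refine lt_of_le_of_lt (b := d - 1) (totalDegree_add_le_of_le ?_
      ((totalDegree_C _).trans_le (Nat.zero_le _))) (by omega)
    exact totalDegree_finsetSum_le fun i _ =>
      (totalDegree_polynomial_aeval_X_le _ _).trans (natDegree_T_sub_chebTop d)
  · funext i
    have := hx i
    rwa [eval_pderiv_sum_aeval_X, eval_derivative_chebTop_eq_zero_iff hd] at this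

/-- The critical points of `T_d`, tagged with `(T_d(x) + 1) / 2`. -/
noncomputable def taggedChebCrit (d : ℕ) : Finset (Σ _ : ℤ, ℂ) :=
  ({0, 1} : Finset ℤ).sigma (chebCrit d)

theorem mem_taggedChebCrit (hd : d ≠ 0) {s : Σ _ : ℤ, ℂ} :
    s ∈ taggedChebCrit d ↔ (derivative (T ℂ d)).eval s.2 = 0 ∧ (T ℂ d).eval s.2 = 2 * s.1 - 1 := by
  rw [taggedChebCrit, Finset.mem_sigma, mem_chebCrit hd]
  refine ⟨fun h => h.2, fun h => ⟨?_, h⟩⟩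
  have h1 := eval_T_sq_of_eval_derivative_eq_zero hd h.1
  rw [h.2] at h1
  have h2 : (2 * s.1 - 1) ^ 2 = 1 := by exact_mod_cast h1
  have h3 : s.1 * (s.1 - 1) = 0 := by linarith
  rcases mul_eq_zero.1 h3 with h4 | h4
  · simp [h4]
  · simp [sub_eq_zero.1 h4]

theorem singular_tchm_subset (hd : d ≠ 0) : {x | IsSingularAt (tchm n d) x} ⊆
    (fun (σ : Fin n → Σ _ : ℤ, ℂ) i => (σ i).2) ''
      ({σ ∈ Fintype.piFinset fun _ : Fin n => taggedChebCrit d |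
        ∑ i, (σ i).1 = ((n / 2 : ℕ) : ℤ)} : Finset _) := by
  rintro x ⟨h0, h1⟩
  have hcrit (i : Fin n) : (derivative (T ℂ d)).eval (x i) = 0 := by
    rw [← h1 i, tchm, map_add, ← map_natCast C, pderiv_C, add_zero]
    exact (eval_pderiv_sum_aeval_X _ _ _).symm
  have hv (i : Fin n) : ∃ v : ℤ, (T ℂ d).eval (x i) = 2 * v - 1 := by
    rcases sq_eq_one_iff.1 (eval_T_sq_of_eval_derivative_eq_zero hd (hcrit i)) with h | h
    · exact ⟨1, by rw [h]; norm_num⟩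
    · exact ⟨0, by rw [h]; norm_num⟩
  choose v hv using hv
  refine ⟨fun i => ⟨v i, x i⟩, ?_, rfl⟩
  rw [Finset.mem_coe, Finset.mem_filter, Fintype.mem_piFinset]
  refine ⟨fun i => (mem_taggedChebCrit hd).2 ⟨hcrit i, hv i⟩, ?_⟩
  simp only [tchm, chebT, map_add, map_sum, eval_aeval_X, hv, map_natCast,
    Finset.sum_sub_distrib, Finset.sum_const, Finset.card_univ, Fintype.card_fin, nsmul_eq_mul,
    mul_one, ← Finset.mul_sum] at h0
  have h2 : 2 * ∑ i, v i - n + ((n % 2 : ℕ) : ℤ) = 0 := by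
    generalize n % 2 = r at h0 ⊢
    exact_mod_cast h0
  change ∑ i, v i = _
  omega

theorem finite_nodes_tchm (hd : 2 ≤ d) : (nodes (tchm n d)).Finite :=
  ((((Finset.finite_toSet _).image _).subset (singular_tchm_subset (by omega))).image _).subset
    (nodes_subset_image_affinePoint (smoothAtInfinity_tchm hd))

theorem nodeCount_tchm_le (hd : 2 ≤ d) : nodeCount (tchm n d) ≤
    ({σ ∈ Fintype.piFinset fun _ : Fin n => taggedChebCrit d |
        ∑ i, (σ i).1 = ((n / 2 : ℕ) : ℤ)} : Finset _).card := by
  have hfin := ((Finset.finite_toSet _).image _).subset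
    (singular_tchm_subset (n := n) (d := d) (by omega))
  calc nodeCount (tchm n d) ≤ (affinePoint '' {x | IsSingularAt (tchm n d) x}).ncard :=
        Set.ncard_le_ncard (nodes_subset_image_affinePoint (smoothAtInfinity_tchm hd))
          (hfin.image _)
    _ ≤ {x | IsSingularAt (tchm n d) x}.ncard := Set.ncard_image_le hfin
    _ ≤ _ := Set.ncard_le_ncard (singular_tchm_subset (by omega))
        ((Finset.finite_toSet _).image _)
    _ ≤ _ := Set.ncard_image_le (Finset.finite_toSet _)
    _ = _ := Set.ncard_coe_finset _

/-- The first coordinate of the `i`-th pair. -/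
abbrev evenIdx (i : Fin (n / 2)) : Fin n := ⟨2 * i, by omega⟩

/-- The second coordinate of the `i`-th pair. -/
abbrev oddIdx (i : Fin (n / 2)) : Fin n := ⟨2 * i + 1, by omega⟩

/-- The sum of the values `ε i • P` at the consecutive pairs of coordinates, plus the value of `R`
at the last coordinate if the number of coordinates is odd. -/
noncomputable def pairSum (ε : ℕ → ℤ) (n : ℕ) (P : MvPolynomial (Fin 2) ℂ) (R : Polynomial ℂ) :
    MvPolynomial (Fin n) ℂ :=
  (∑ i : Fin (n / 2), (ε i : MvPolynomial (Fin n) ℂ) * aeval ![X (evenIdx i), X (oddIdx i)] P)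
    + if h : n % 2 = 1 then Polynomial.aeval (X ⟨n - 1, by omega⟩) R else 0

theorem chmB2_eq_pairSum (ε : ℕ → ℤ) : chmB2 ε n d =
    pairSum ε n (foldB2 d) (Polynomial.C (1 / 2) * (T ℂ d + 1)) := by
  simp only [chmB2, pairSum, map_mul, map_add, map_one, Polynomial.aeval_C, chebT, algebraMap_eq]

theorem index_cases (j : Fin n) : (∃ i : Fin (n / 2), j = evenIdx i) ∨
    (∃ i : Fin (n / 2), j = oddIdx i) ∨ ∃ h : n % 2 = 1, j = ⟨n - 1, by omega⟩ := by
  by_cases h : (j : ℕ) / 2 < n / 2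
  · rcases Nat.mod_two_eq_zero_or_one j with h2 | h2
    · exact Or.inl ⟨⟨j / 2, h⟩, Fin.ext (by simp only; omega)⟩
    · exact Or.inr (Or.inl ⟨⟨j / 2, h⟩, Fin.ext (by simp only; omega)⟩)
  · have := j.2
    exact Or.inr (Or.inr ⟨by omega, Fin.ext (by simp only; omega)⟩)

theorem pderiv_intCast_mul_aeval_pair (e : ℤ) (a b j : Fin n) (P : MvPolynomial (Fin 2) ℂ) :
    pderiv j ((e : MvPolynomial (Fin n) ℂ) * aeval ![X a, X b] P) =
      (e : MvPolynomial (Fin n) ℂ) * (aeval ![X a, X b] (pderiv 0 P) * pderiv j (X a) +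
        aeval ![X a, X b] (pderiv 1 P) * pderiv j (X b)) := by
  rw [← map_intCast (C : ℂ →+* MvPolynomial (Fin n) ℂ), pderiv_C_mul, derivation_aeval, Fin.sum_univ_two]
  rfl

theorem pderiv_pairSum_last_term (j : Fin n) (R : Polynomial ℂ)
    (hj : ∀ h : n % 2 = 1, j ≠ ⟨n - 1, by omega⟩) :
    pderiv j (if h : n % 2 = 1 then Polynomial.aeval (X (⟨n - 1, by omega⟩ : Fin n)) R else
      (0 : MvPolynomial (Fin n) ℂ)) = 0 := by
  split_ifs with h
  · rw [Derivation.map_aeval, pderiv_X_of_ne (hj h).symm, smul_zero]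
  · rw [map_zero]

theorem evenIdx_injective : Function.Injective (evenIdx (n := n)) := fun i k h => by
  have : 2 * (i : ℕ) = 2 * k := congrArg Fin.val h
  exact Fin.ext (by omega)

theorem oddIdx_injective : Function.Injective (oddIdx (n := n)) := fun i k h => by
  have : 2 * (i : ℕ) + 1 = 2 * k + 1 := congrArg Fin.val h
  exact Fin.ext (by omega)

theorem evenIdx_ne_oddIdx (i k : Fin (n / 2)) : evenIdx i ≠ oddIdx k := fun h => by
  have : 2 * (i : ℕ) = 2 * k + 1 := congrArg Fin.val h
  omega

theorem evenIdx_ne_last (i : Fin (n / 2)) (h : n % 2 = 1) : evenIdx i ≠ ⟨n - 1, by omega⟩ :=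
  fun e => by
    have : 2 * (i : ℕ) = n - 1 := congrArg Fin.val e
    omega

theorem oddIdx_ne_last (i : Fin (n / 2)) (h : n % 2 = 1) : oddIdx i ≠ ⟨n - 1, by omega⟩ :=
  fun e => by
    have : 2 * (i : ℕ) + 1 = n - 1 := congrArg Fin.val e
    omega

theorem pderiv_evenIdx_pairSum (ε : ℕ → ℤ) (P : MvPolynomial (Fin 2) ℂ) (R : Polynomial ℂ)
    (i : Fin (n / 2)) : pderiv (evenIdx i) (pairSum ε n P R) =
      (ε i : MvPolynomial (Fin n) ℂ) * aeval ![X (evenIdx i), X (oddIdx i)] (pderiv 0 P) := by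
  rw [pairSum, map_add, map_sum, pderiv_pairSum_last_term _ _ (evenIdx_ne_last i), add_zero,
    Finset.sum_eq_single i, pderiv_intCast_mul_aeval_pair, pderiv_X_self,
    pderiv_X_of_ne (evenIdx_ne_oddIdx _ _).symm]
  · ring
  · intro k _ hk
    rw [pderiv_intCast_mul_aeval_pair, pderiv_X_of_ne (evenIdx_injective.ne hk),
      pderiv_X_of_ne (evenIdx_ne_oddIdx _ _).symm, mul_zero, mul_zero, add_zero, mul_zero]
  · simp

theorem pderiv_oddIdx_pairSum (ε : ℕ → ℤ) (P : MvPolynomial (Fin 2) ℂ) (R : Polynomial ℂ)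
    (i : Fin (n / 2)) : pderiv (oddIdx i) (pairSum ε n P R) =
      (ε i : MvPolynomial (Fin n) ℂ) * aeval ![X (evenIdx i), X (oddIdx i)] (pderiv 1 P) := by
  rw [pairSum, map_add, map_sum, pderiv_pairSum_last_term _ _ (oddIdx_ne_last i), add_zero,
    Finset.sum_eq_single i, pderiv_intCast_mul_aeval_pair, pderiv_X_self,
    pderiv_X_of_ne (evenIdx_ne_oddIdx _ _)]
  · ring
  · intro k _ hk
    rw [pderiv_intCast_mul_aeval_pair, pderiv_X_of_ne (oddIdx_injective.ne hk),
      pderiv_X_of_ne (evenIdx_ne_oddIdx _ _), mul_zero, mul_zero, add_zero, mul_zero]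
  · simp

theorem pderiv_last_pairSum (ε : ℕ → ℤ) (P : MvPolynomial (Fin 2) ℂ) (R : Polynomial ℂ)
    (h : n % 2 = 1) : pderiv ⟨n - 1, by omega⟩ (pairSum ε n P R) =
      Polynomial.aeval (X ⟨n - 1, by omega⟩) (derivative R) := by
  rw [pairSum, map_add, map_sum, dif_pos h, Finset.sum_eq_zero, zero_add, Derivation.map_aeval,
    pderiv_X_self, smul_eq_mul, mul_one]
  intro k _
  rw [pderiv_intCast_mul_aeval_pair, pderiv_X_of_ne (evenIdx_ne_last k h),
    pderiv_X_of_ne (oddIdx_ne_last k h), mul_zero, mul_zero, add_zero, mul_zero]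

theorem eval_aeval_pair (x : Fin n → ℂ) (a b : Fin n) (P : MvPolynomial (Fin 2) ℂ) :
    eval x (aeval ![(X a : MvPolynomial (Fin n) ℂ), X b] P) = eval ![x a, x b] P := by
  rw [← coe_aeval_eq_eval, ← coe_aeval_eq_eval, RingHom.coe_coe, RingHom.coe_coe,
    ← AlgHom.comp_apply]
  congr 1
  ext k
  fin_cases k <;> simp

/-- The gradient of `pairSum` vanishes exactly where the gradients of all summands do. -/
theorem pderiv_pairSum_eq_zero_iff {ε : ℕ → ℤ} (hε : ∀ i, ε i ≠ 0) (P : MvPolynomial (Fin 2) ℂ)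
    (R : Polynomial ℂ) (x : Fin n → ℂ) : (∀ j, eval x (pderiv j (pairSum ε n P R)) = 0) ↔
      (∀ i : Fin (n / 2), eval ![x (evenIdx i), x (oddIdx i)] (pderiv 0 P) = 0 ∧
        eval ![x (evenIdx i), x (oddIdx i)] (pderiv 1 P) = 0) ∧
      ∀ h : n % 2 = 1, (derivative R).eval (x ⟨n - 1, by omega⟩) = 0 := by
  have hε' (i : Fin (n / 2)) : (ε i : ℂ) ≠ 0 := Int.cast_ne_zero.2 (hε i)
  constructor
  · refine fun hx => ⟨fun i => ⟨?_, ?_⟩, fun h => ?_⟩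
    · have := hx (evenIdx i)
      rw [pderiv_evenIdx_pairSum, map_mul, map_intCast, eval_aeval_pair] at this
      exact (mul_eq_zero.1 this).resolve_left (hε' i)
    · have := hx (oddIdx i)
      rw [pderiv_oddIdx_pairSum, map_mul, map_intCast, eval_aeval_pair] at this
      exact (mul_eq_zero.1 this).resolve_left (hε' i)
    · have := hx ⟨n - 1, by omega⟩
      rwa [pderiv_last_pairSum _ _ _ h, eval_aeval_X] at this
  · rintro ⟨h1, h2⟩ j
    rcases index_cases j with ⟨i, rfl⟩ | ⟨i, rfl⟩ | ⟨h, rfl⟩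
    · rw [pderiv_evenIdx_pairSum, map_mul, eval_aeval_pair, (h1 i).1, mul_zero]
    · rw [pderiv_oddIdx_pairSum, map_mul, eval_aeval_pair, (h1 i).2, mul_zero]
    · rw [pderiv_last_pairSum _ _ _ h, eval_aeval_X, h2 h]

theorem isHomogeneous_pairSum (ε : ℕ → ℤ) {P : MvPolynomial (Fin 2) ℂ} {c : ℂ}
    (hP : P.IsHomogeneous d) : (pairSum ε n P (Polynomial.C c * chebTop d)).IsHomogeneous d := by
  refine IsHomogeneous.add (IsHomogeneous.sum _ _ _ fun i _ => ?_) ?_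
  · rw [← map_intCast (C : ℂ →+* MvPolynomial (Fin n) ℂ)]
    refine IsHomogeneous.C_mul ?_ _
    have := hP.aeval ![X (evenIdx i), X (oddIdx i)] (n := 1) fun k => by
      fin_cases k
      · exact isHomogeneous_X ℂ (evenIdx i)
      · exact isHomogeneous_X ℂ (oddIdx i)
    rwa [one_mul] at this
  · split_ifs with h
    · rw [map_mul, Polynomial.aeval_C, algebraMap_eq]
      exact (isHomogeneous_aeval_chebTop d _).C_mul _
    · exact isHomogeneous_zero _ _ _

theorem totalDegree_pairSum_le (ε : ℕ → ℤ) {P : MvPolynomial (Fin 2) ℂ} {R : Polynomial ℂ} {k : ℕ}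
    (hP : P.totalDegree ≤ k) (hR : R.natDegree ≤ k) : (pairSum ε n P R).totalDegree ≤ k := by
  refine totalDegree_add_le_of_le (totalDegree_finsetSum_le fun i _ => ?_) ?_
  · rw [← map_intCast (C : ℂ →+* MvPolynomial (Fin n) ℂ)]
    refine totalDegree_mul_le_of_le (a := 0) (b := k) (totalDegree_C _).le ?_ (by omega)
    have : aeval ![(X (evenIdx i) : MvPolynomial (Fin n) ℂ), X (oddIdx i)] =
        (rename ![evenIdx i, oddIdx i] : MvPolynomial (Fin 2) ℂ →ₐ[ℂ] _) := by
      refine algHom_ext fun k => ?_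
      fin_cases k <;> simp
    rw [this]
    exact (totalDegree_rename_le _ _).trans hP
  · split_ifs with h
    · exact (totalDegree_polynomial_aeval_X_le _ _).trans hR
    · simp

theorem pairSum_sub (ε : ℕ → ℤ) (P P' : MvPolynomial (Fin 2) ℂ) (R R' : Polynomial ℂ) :
    pairSum ε n P R - pairSum ε n P' R' = pairSum ε n (P - P') (R - R') := by
  simp only [pairSum, map_sub, mul_sub, Finset.sum_sub_distrib]
  split_ifs <;> ring

theorem smoothAtInfinity_chmB2 {ε : ℕ → ℤ} (hε : ∀ i, ε i ≠ 0) (hd : 2 ≤ d) :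
    SmoothAtInfinity (chmB2 ε n d) := by
  rw [chmB2_eq_pairSum]
  refine smoothAtInfinity_of_totalDegree_sub_lt
    (isHomogeneous_pairSum ε (c := 1 / 2) (isHomogeneous_foldTop d)) ?_ fun x hx => ?_
  · rw [pairSum_sub]
    refine lt_of_le_of_lt (b := d - 1) (totalDegree_pairSum_le ε ?_ ?_) (by omega)
    · have := totalDegree_foldB2_sub_foldTop (d - 1)
      rwa [Nat.sub_add_cancel (by omega)] at this
    · rw [← mul_sub]
      refine Polynomial.natDegree_C_mul_le _ _ |>.trans ?_
      rw [add_sub_right_comm]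
      exact Polynomial.natDegree_add_le_of_degree_le (natDegree_T_sub_chebTop d) (by simp)
  · rw [pderiv_pairSum_eq_zero_iff hε] at hx
    have hpair (i : Fin (n / 2)) : ![x (evenIdx i), x (oddIdx i)] = 0 :=
      eq_zero_of_pderiv_foldTop_eq_zero (d := d) (by omega) fun k => by
        fin_cases k
        · exact (hx.1 i).1
        · exact (hx.1 i).2
    funext j
    rcases index_cases j with ⟨i, rfl⟩ | ⟨i, rfl⟩ | ⟨h, rfl⟩
    · exact congrFun (hpair i) 0
    · exact congrFun (hpair i) 1
    · have := hx.2 h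
      rw [Polynomial.derivative_C_mul, Polynomial.eval_C_mul, mul_eq_zero,
        or_iff_right (by norm_num), eval_derivative_chebTop_eq_zero_iff hd] at this
      exact this

theorem finite_nodes_chmB2 {ε : ℕ → ℤ} (hε : ∀ i, ε i ≠ 0) (hd : 2 ≤ d) :
    (nodes (chmB2 ε n d)).Finite := by
  refine Set.Finite.subset (Set.Finite.image _ ?_)
    (nodes_subset_image_affinePoint (smoothAtInfinity_chmB2 hε hd))
  have hd0 : d ≠ 0 := by omega
  have hK := finite_isFoldCritical hd0
  have hC : {t : ℂ | (derivative (T ℂ d)).eval t = 0}.Finite := by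
    refine (Finset.finite_toSet (derivative (T ℂ d)).roots.toFinset).subset fun t ht => ?_
    simpa [derivative_T_ne_zero hd0] using ht
  refine Set.Finite.subset (Set.Finite.pi' fun _ : Fin n =>
    ((hK.image Prod.fst).union (hK.image Prod.snd)).union hC) fun x hx j => ?_
  have hx2 := hx.2
  rw [chmB2_eq_pairSum, pderiv_pairSum_eq_zero_iff hε] at hx2
  rcases index_cases j with ⟨i, rfl⟩ | ⟨i, rfl⟩ | ⟨h, rfl⟩
  · exact Or.inl (Or.inl ⟨(x (evenIdx i), x (oddIdx i)), hx2.1 i, rfl⟩)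
  · exact Or.inl (Or.inr ⟨(x (evenIdx i), x (oddIdx i)), hx2.1 i, rfl⟩)
  · refine Or.inr ?_
    have := hx2.2 h
    rw [Polynomial.derivative_C_mul, Polynomial.eval_C_mul, mul_eq_zero,
        or_iff_right (by norm_num), Polynomial.derivative_add, Polynomial.derivative_one,
        add_zero] at this
    exact this

/-- The nondegenerate critical points of `foldB2 d`, tagged with their values. -/
noncomputable def taggedFoldCrit (d : ℕ) : Finset (Σ _ : ℤ, ℂ × ℂ) :=
  ({0, 1, -1} : Finset ℤ).sigma (foldCrit d)

/-- The contributions of an unpaired last coordinate: the tagged critical points of `T_d` if there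
is such a coordinate, and a dummy element otherwise. -/
noncomputable def taggedLast (n d : ℕ) : Finset (Σ _ : ℤ, ℂ) :=
  if n % 2 = 1 then taggedChebCrit d else {⟨0, 0⟩}

/-- The affine point with prescribed pairs of coordinates and prescribed last coordinate. -/
def assemble (ω : (Fin (n / 2) → Σ _ : ℤ, ℂ × ℂ) × Σ _ : ℤ, ℂ) (j : Fin n) : ℂ :=
  if h : (j : ℕ) / 2 < n / 2 then
    if (j : ℕ) % 2 = 0 then (ω.1 ⟨j / 2, h⟩).2.1 else (ω.1 ⟨j / 2, h⟩).2.2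
  else ω.2.2

theorem assemble_evenIdx (ω : (Fin (n / 2) → Σ _ : ℤ, ℂ × ℂ) × Σ _ : ℤ, ℂ) (i : Fin (n / 2)) :
    assemble ω (evenIdx i) = (ω.1 i).2.1 := by
  have h : 2 * (i : ℕ) / 2 = i := by omega
  simp [assemble, h]

theorem assemble_oddIdx (ω : (Fin (n / 2) → Σ _ : ℤ, ℂ × ℂ) × Σ _ : ℤ, ℂ) (i : Fin (n / 2)) :
    assemble ω (oddIdx i) = (ω.1 i).2.2 := by
  have h : (2 * (i : ℕ) + 1) / 2 = i := by omega
  simp [assemble, h, Nat.add_mod]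

theorem assemble_last (ω : (Fin (n / 2) → Σ _ : ℤ, ℂ × ℂ) × Σ _ : ℤ, ℂ) (h : n % 2 = 1) :
    assemble ω ⟨n - 1, by omega⟩ = ω.2.2 := by
  have h' : ¬ (n - 1) / 2 < n / 2 := by omega
  simp [assemble, h']

theorem sum_pderiv_aeval_pair (x u : Fin n → ℂ) (e : ℤ) (a b : Fin n)
    (P : MvPolynomial (Fin 2) ℂ) :
    ∑ j, eval x (pderiv j ((e : MvPolynomial (Fin n) ℂ) * aeval ![X a, X b] P)) * u j =
      e * (eval ![x a, x b] (pderiv 0 P) * u a + eval ![x a, x b] (pderiv 1 P) * u b) := by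
  simp only [pderiv_intCast_mul_aeval_pair, map_mul, map_intCast, map_add, eval_aeval_pair]
  have (a : Fin n) (c : ℂ) : ∑ j, c * eval x (pderiv j (X a)) * u j = c * u a := by
    rw [Finset.sum_eq_single a]
    · simp
    · intro j _ hj
      simp [pderiv_X_of_ne hj.symm]
    · simp
  simp only [mul_add, add_mul, Finset.sum_add_distrib, ← mul_assoc, this]

/-- Choosing a tagged critical point for each pair of coordinates, and for a possible last
coordinate, gives a node as soon as the signed values add up to zero. -/
theorem affinePoint_assemble_mem_nodes {ε : ℕ → ℤ} (hε : ∀ i, ε i ≠ 0) (hd : d ≠ 0)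
    {ω : (Fin (n / 2) → Σ _ : ℤ, ℂ × ℂ) × Σ _ : ℤ, ℂ} (h1 : ∀ i, ω.1 i ∈ taggedFoldCrit d)
    (h2 : ω.2 ∈ taggedLast n d) (hsum : ∑ i : Fin (n / 2), ε i * (ω.1 i).1 + ω.2.1 = 0) :
    affinePoint (assemble ω) ∈ nodes (chmB2 ε n d) := by
  have spec (i : Fin (n / 2)) := by
    have := h1 i
    rw [taggedFoldCrit, Finset.mem_sigma] at this
    exact spec_of_mem_foldCrit hd (by simpa using this.1) this.2
  have hlast (h : n % 2 = 1) := by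
    rw [taggedLast, if_pos h, mem_taggedChebCrit hd] at h2
    exact h2
  rw [chmB2_eq_pairSum]
  refine affinePoint_mem_nodes ⟨?_, ?_⟩ fun u hu => ?_
  · rw [pairSum, map_add, map_sum, ← Int.cast_zero (R := ℂ), ← hsum]
    push_cast
    congr 1
    · refine Finset.sum_congr rfl fun i _ => ?_
      rw [map_mul, map_intCast, eval_aeval_pair, assemble_evenIdx, assemble_oddIdx, (spec i).1]
    · split_ifs with h
      · rw [eval_aeval_X, assemble_last _ h, Polynomial.eval_C_mul, Polynomial.eval_add,
          (hlast h).2, Polynomial.eval_one]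
        ring
      · rw [taggedLast, if_neg h, Finset.mem_singleton] at h2
        simp [h2]
  · rw [pderiv_pairSum_eq_zero_iff hε]
    refine ⟨fun i => ?_, fun h => ?_⟩
    · rw [assemble_evenIdx, assemble_oddIdx]
      exact (spec i).2.1
    · rw [assemble_last _ h]
      simp [(hlast h).1]
  · have hpair (i : Fin (n / 2)) : u (evenIdx i) = 0 ∧ u (oddIdx i) = 0 := by
      have hε' : (ε i : ℂ) ≠ 0 := Int.cast_ne_zero.2 (hε i)
      have r0 := hu (evenIdx i)
      have r1 := hu (oddIdx i)
      simp only [pderiv_comm (evenIdx i), pderiv_evenIdx_pairSum, pderiv_comm (oddIdx i),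
        pderiv_oddIdx_pairSum, sum_pderiv_aeval_pair, assemble_evenIdx, assemble_oddIdx,
        mul_eq_zero, hε', false_or] at r0 r1
      rw [pderiv_comm 1 0] at r0
      have hdet := (spec i).2.2
      constructor
      · refine (mul_eq_zero.1 (?_ : _ * u (evenIdx i) = 0)).resolve_left hdet
        linear_combination eval ![(ω.1 i).2.1, (ω.1 i).2.2] (pderiv 1 (pderiv 1 (foldB2 d))) * r0
          - eval ![(ω.1 i).2.1, (ω.1 i).2.2] (pderiv 0 (pderiv 1 (foldB2 d))) * r1
      · refine (mul_eq_zero.1 (?_ : _ * u (oddIdx i) = 0)).resolve_left hdet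
        linear_combination eval ![(ω.1 i).2.1, (ω.1 i).2.2] (pderiv 0 (pderiv 0 (foldB2 d))) * r1
          - eval ![(ω.1 i).2.1, (ω.1 i).2.2] (pderiv 0 (pderiv 1 (foldB2 d))) * r0
    funext j
    rcases index_cases j with ⟨i, rfl⟩ | ⟨i, rfl⟩ | ⟨h, rfl⟩
    · exact (hpair i).1
    · exact (hpair i).2
    · have r := hu ⟨n - 1, by omega⟩
      simp only [pderiv_comm (⟨n - 1, by omega⟩ : Fin n), pderiv_last_pairSum _ _ _ h,
        Derivation.map_aeval] at r
      rw [Finset.sum_eq_single ⟨n - 1, by omega⟩] at r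
      · rw [pderiv_X_self, smul_eq_mul, mul_one, eval_aeval_X, assemble_last _ h] at r
        refine (mul_eq_zero.1 r).resolve_left ?_
        simpa using eval_derivative_derivative_T_ne_zero hd (hlast h).1
      · intro j _ hj
        rw [pderiv_X_of_ne hj.symm, smul_zero, map_zero, zero_mul]
      · simp

theorem le_nodeCount_chmB2 {ε : ℕ → ℤ} (hε : ∀ i, ε i ≠ 0) (hd : 2 ≤ d) :
    ({ω ∈ (Fintype.piFinset fun _ : Fin (n / 2) => taggedFoldCrit d) ×ˢ taggedLast n d |
      ∑ i : Fin (n / 2), ε i * (ω.1 i).1 + ω.2.1 = 0} : Finset _).card ≤ nodeCount (chmB2 ε n d) := by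
  rw [← Set.ncard_coe_finset]
  refine Set.ncard_le_ncard_of_injOn (fun ω => affinePoint (assemble ω)) ?_ ?_
    (finite_nodes_chmB2 hε hd)
  · intro ω hω
    simp only [Finset.coe_filter, Finset.mem_product, Fintype.mem_piFinset,
      Set.mem_ofPred_eq] at hω
    exact affinePoint_assemble_mem_nodes hε (by omega) hω.1.1 hω.1.2 hω.2
  · intro ω hω ω' hω' h
    simp only [Finset.coe_filter, Finset.mem_product, Fintype.mem_piFinset,
      Set.mem_ofPred_eq] at hω hω'
    have hd0 : d ≠ 0 := by omega
    have he := affinePoint_injective h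
    refine Prod.ext (funext fun i => ?_) ?_
    · have e0 := congrFun he (evenIdx i)
      have e1 := congrFun he (oddIdx i)
      rw [assemble_evenIdx, assemble_evenIdx] at e0
      rw [assemble_oddIdx, assemble_oddIdx] at e1
      have e2 := Prod.ext e0 e1
      have m := Finset.mem_sigma.1 (hω.1.1 i)
      have m' := Finset.mem_sigma.1 (hω'.1.1 i)
      have s := (spec_of_mem_foldCrit hd0 (by simpa using m.1) m.2).1
      have s' := (spec_of_mem_foldCrit hd0 (by simpa using m'.1) m'.2).1
      rw [e2, s'] at s
      exact Sigma.ext (by exact_mod_cast s.symm) (heq_of_eq e2)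
    · have m := hω.1.2
      have m' := hω'.1.2
      unfold taggedLast at m m'
      split_ifs at m m' with hn
      · have e := congrFun he ⟨n - 1, by omega⟩
        rw [assemble_last _ hn, assemble_last _ hn] at e
        rw [mem_taggedChebCrit hd0] at m m'
        have s := m.2
        rw [e, m'.2] at s
        have s1 : 2 * ω'.2.1 - 1 = 2 * ω.2.1 - 1 := by exact_mod_cast s
        exact Sigma.ext (by omega) (heq_of_eq e)
      · rw [Finset.mem_singleton] at m m'
        rw [m, m']

end Singularities

/-! ### Counting by averages over roots of unity -/

section Averages

theorem sum_zpow_pow {N : ℕ} {ζ : ℂ} (hζ : IsPrimitiveRoot ζ N) {s : ℤ}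
    (hs : |s| < N) : ∑ k ∈ Finset.range N, (ζ ^ k) ^ s = if s = 0 then (N : ℂ) else 0 := by
  split_ifs with h
  · simp [h]
  · have h1 : ζ ^ s ≠ 1 := by
      rw [Ne, hζ.zpow_eq_one_iff_dvd]
      intro hdvd
      exact h (Int.eq_zero_of_abs_lt_dvd hdvd hs)
    have h2 : (ζ ^ s) ^ N = 1 := by
      rw [← zpow_natCast, zpow_comm, zpow_natCast, hζ.pow_eq_one, one_zpow]
    have h3 (k : ℕ) : (ζ ^ k) ^ s = (ζ ^ s) ^ k := by
      rw [← zpow_natCast, ← zpow_natCast, zpow_comm]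
    simp only [h3]
    rw [geom_sum_eq h1, h2, sub_self, zero_div]

theorem zpow_sum {ι : Type*} {z : ℂ} (hz : z ≠ 0) (s : Finset ι) (f : ι → ℤ) :
    z ^ ∑ i ∈ s, f i = ∏ i ∈ s, z ^ f i := by
  classical
  induction s using Finset.induction_on with
  | empty => simp
  | insert a s ha ih => rw [Finset.sum_insert ha, Finset.prod_insert ha, zpow_add₀ hz, ih]

/-- A discrete Cauchy formula; the radius `ρ` of the circle is arbitrary. -/
theorem natCast_mul_card_filter_eq_zero {α : Type*} {N : ℕ} {ζ : ℂ} (hζ : IsPrimitiveRoot ζ N)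
    (ρ : ℂ) (Ω : Finset α) (S : α → ℤ) (hS : ∀ ω ∈ Ω, |S ω| < N) :
    (N : ℂ) * ({ω ∈ Ω | S ω = 0} : Finset α).card =
      ∑ k ∈ Finset.range N, ∑ ω ∈ Ω, (ρ * ζ ^ k) ^ S ω := by
  rw [Finset.sum_comm, Finset.card_filter, Nat.cast_sum, Finset.mul_sum]
  refine Finset.sum_congr rfl fun ω hω => ?_
  simp only [mul_zpow, ← Finset.mul_sum, sum_zpow_pow hζ (hS ω hω)]
  split_ifs with h <;> simp [h]

variable {n d : ℕ}

theorem sum_taggedChebCrit (d : ℕ) (z : ℂ) : ∑ s ∈ taggedChebCrit d, z ^ s.1 =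
    ((d - 1) / 2 : ℕ) * z + (d / 2 : ℕ) := by
  rw [taggedChebCrit, Finset.sum_sigma, Finset.sum_pair zero_ne_one]
  simp only [Finset.sum_const, (card_chebCrit d).1, (card_chebCrit d).2, nsmul_eq_mul, zpow_zero,
    zpow_one, mul_one]
  ring

theorem sum_taggedFoldCrit (d : ℕ) (z : ℂ) : ∑ s ∈ taggedFoldCrit d, z ^ s.1 =
    (foldCrit d 0).card + (foldCrit d 1).card * z + (foldCrit d (-1)).card * z⁻¹ := by
  rw [taggedFoldCrit, Finset.sum_sigma, Finset.sum_insert (by decide),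
    Finset.sum_pair (by decide)]
  simp only [Finset.sum_const, nsmul_eq_mul, zpow_zero, zpow_one, mul_one, zpow_neg_one]
  ring

theorem natCast_mul_nodeCount_tchm_le (hd : 2 ≤ d) {N : ℕ} (hN : n < N) {ζ : ℂ}
    (hζ : IsPrimitiveRoot ζ N) {ρ : ℂ} (hρ : ρ ≠ 0) : (N : ℝ) * nodeCount (tchm n d) ≤
      (∑ k ∈ Finset.range N, (((d - 1) / 2 : ℕ) * (ρ * ζ ^ k) + (d / 2 : ℕ)) ^ n *
        ((ρ * ζ ^ k)⁻¹) ^ (n / 2)).re := by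
  set Ω := Fintype.piFinset fun _ : Fin n => taggedChebCrit d with hΩ
  have hmem (σ) (hσ : σ ∈ Ω) (i : Fin n) : 0 ≤ (σ i).1 ∧ (σ i).1 ≤ 1 := by
    have := Fintype.mem_piFinset.1 hσ i
    rw [taggedChebCrit, Finset.mem_sigma, Finset.mem_insert, Finset.mem_singleton] at this
    rcases this.1 with h | h <;> rw [h] <;> norm_num
  have hS (σ) (hσ : σ ∈ Ω) : |∑ i, (σ i).1 - ((n / 2 : ℕ) : ℤ)| < N := by
    have h0 : 0 ≤ ∑ i, (σ i).1 := Finset.sum_nonneg fun i _ => (hmem σ hσ i).1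
    have h1 : ∑ i, (σ i).1 ≤ n := by
      refine (Finset.sum_le_sum fun i _ => (hmem σ hσ i).2).trans ?_
      simp
    rw [abs_lt]
    omega
  have h := natCast_mul_card_filter_eq_zero hζ ρ Ω _ hS
  have hζ0 : ζ ≠ 0 := hζ.ne_zero (by omega)
  have hsum (z : ℂ) (hz : z ≠ 0) : ∑ σ ∈ Ω, z ^ (∑ i, (σ i).1 - ((n / 2 : ℕ) : ℤ)) =
      (((d - 1) / 2 : ℕ) * z + (d / 2 : ℕ)) ^ n * (z⁻¹) ^ (n / 2) := by
    simp only [zpow_sub₀ hz, zpow_natCast, div_eq_mul_inv, ← Finset.sum_mul]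
    rw [inv_pow]
    congr 1
    have := Finset.prod_univ_sum (fun _ : Fin n => taggedChebCrit d) fun _ s => z ^ s.1
    simp only [sum_taggedChebCrit, Finset.prod_const, Finset.card_univ, Fintype.card_fin] at this
    rw [this]
    refine Finset.sum_congr rfl fun σ _ => ?_
    exact zpow_sum hz _ _
  simp only [sub_eq_zero] at h
  rw [← Finset.sum_congr rfl fun k _ => hsum _ (mul_ne_zero hρ (pow_ne_zero k hζ0)), ← h]
  have := nodeCount_tchm_le (n := n) hd
  rw [← Nat.cast_mul, ← Nat.cast_mul, Complex.natCast_re]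
  exact_mod_cast Nat.mul_le_mul_left N this

theorem le_natCast_mul_nodeCount_chmB2 {ε : ℕ → ℤ} (hε : ∀ i, |ε i| = 1) (hd : 2 ≤ d) {N : ℕ}
    (hN : n / 2 + 1 < N) {ζ : ℂ} (hζ : IsPrimitiveRoot ζ N) {ρ : ℂ} (hρ : ρ ≠ 0) :
    (∑ k ∈ Finset.range N, (∏ i ∈ Finset.range (n / 2), ((foldCrit d 0).card +
        (foldCrit d 1).card * (ρ * ζ ^ k) ^ ε i +
        (foldCrit d (-1)).card * ((ρ * ζ ^ k) ^ ε i)⁻¹)) *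
      (((d - 1) / 2 : ℕ) * (ρ * ζ ^ k) + (d / 2 : ℕ)) ^ (n % 2)).re ≤
      (N : ℝ) * nodeCount (chmB2 ε n d) := by
  set Ω := (Fintype.piFinset fun _ : Fin (n / 2) => taggedFoldCrit d) ×ˢ taggedLast n d with hΩ
  have hS (ω) (hω : ω ∈ Ω) : |∑ i : Fin (n / 2), ε i * (ω.1 i).1 + ω.2.1| < N := by
    rw [hΩ, Finset.mem_product, Fintype.mem_piFinset] at hω
    have h1 : |∑ i : Fin (n / 2), ε i * (ω.1 i).1| ≤ ((n / 2 : ℕ) : ℤ) := by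
      refine (Finset.abs_sum_le_sum_abs _ _).trans ?_
      refine (Finset.sum_le_sum (g := fun _ => 1) fun i _ => ?_).trans (by simp)
      rw [abs_mul, hε, one_mul]
      have := hω.1 i
      rw [taggedFoldCrit, Finset.mem_sigma] at this
      simp only [Finset.mem_insert, Finset.mem_singleton] at this
      rcases this.1 with h | h | h <;> rw [h] <;> norm_num
    have h2 : |ω.2.1| ≤ 1 := by
      have := hω.2
      unfold taggedLast at this
      split_ifs at this
      · rw [taggedChebCrit, Finset.mem_sigma, Finset.mem_insert, Finset.mem_singleton] at this
        rcases this.1 with h | h <;> rw [h] <;> norm_num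
      · rw [Finset.mem_singleton.1 this]
        norm_num
    have := abs_add_le (∑ i : Fin (n / 2), ε i * (ω.1 i).1) ω.2.1
    omega
  have h := natCast_mul_card_filter_eq_zero hζ ρ Ω _ hS
  have hζ0 : ζ ≠ 0 := hζ.ne_zero (by omega)
  have hlast (z : ℂ) : ∑ s ∈ taggedLast n d, z ^ s.1 =
      (((d - 1) / 2 : ℕ) * z + (d / 2 : ℕ)) ^ (n % 2) := by
    unfold taggedLast
    split_ifs with hn
    · rw [sum_taggedChebCrit, hn, pow_one]
    · rw [Nat.mod_two_ne_one.1 hn, pow_zero, Finset.sum_singleton, zpow_zero]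
  have hsum (z : ℂ) (hz : z ≠ 0) :
      ∑ ω ∈ Ω, z ^ (∑ i : Fin (n / 2), ε i * (ω.1 i).1 + ω.2.1) =
      (∏ i ∈ Finset.range (n / 2), ((foldCrit d 0).card + (foldCrit d 1).card * z ^ ε i +
        (foldCrit d (-1)).card * (z ^ ε i)⁻¹)) *
      (((d - 1) / 2 : ℕ) * z + (d / 2 : ℕ)) ^ (n % 2) := by
    have h1 := Finset.prod_univ_sum (fun _ : Fin (n / 2) => taggedFoldCrit d)
      fun i s => (z ^ ε i) ^ s.1
    simp only [sum_taggedFoldCrit] at h1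
    rw [Finset.prod_range, h1, ← hlast, Finset.sum_mul_sum, hΩ, Finset.sum_product]
    refine Finset.sum_congr rfl fun κ _ => Finset.sum_congr rfl fun s _ => ?_
    rw [zpow_add₀ hz]
    congr 1
    simp only [← zpow_mul]
    exact zpow_sum hz _ _
  rw [← Finset.sum_congr rfl fun k _ => hsum _ (mul_ne_zero hρ (pow_ne_zero k hζ0)), ← h]
  have := le_nodeCount_chmB2 (n := n) (ε := ε) (fun i h0 => by simpa [h0] using hε i) hd
  rw [← Nat.cast_mul, ← Nat.cast_mul, Complex.natCast_re]
  exact_mod_cast Nat.mul_le_mul_left N this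

/-- The contribution of one root of unity to the number of nodes of `TChm` is real up to the
factor `1 + z`; the radius of the circle is chosen to balance the two critical values. -/
theorem natCast_mul_nodeCount_tchm_le_sum (hd : 3 ≤ d) {N : ℕ} (hN : n < N) {ζ : ℂ}
    (hζ : IsPrimitiveRoot ζ N) : (N : ℝ) * nodeCount (tchm n d) ≤
      ∑ k ∈ Finset.range N, ((((d - 1) / 2 : ℕ) * (d / 2 : ℕ) : ℝ) * (2 + 2 * (ζ ^ k).re)) ^ (n / 2) *
        ((d / 2 : ℕ) * (1 + (ζ ^ k).re)) ^ (n % 2) := by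
  have hζ0 : ζ ≠ 0 := hζ.ne_zero (by omega)
  have he : (((d - 1) / 2 : ℕ) : ℂ) ≠ 0 := Nat.cast_ne_zero.2 (by omega)
  have ho : ((d / 2 : ℕ) : ℂ) ≠ 0 := Nat.cast_ne_zero.2 (by omega)
  refine (natCast_mul_nodeCount_tchm_le (by omega) hN hζ (div_ne_zero ho he)).trans_eq ?_
  rw [Complex.re_sum]
  refine Finset.sum_congr rfl fun k _ => ?_
  generalize (((d - 1) / 2 : ℕ)) = e at *
  generalize (d / 2 : ℕ) = o at *
  have hz : ζ ^ k ≠ 0 := pow_ne_zero k hζ0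
  have hnorm : ‖ζ ^ k‖ = 1 := by rw [norm_pow, hζ.norm'_eq_one (by omega), one_pow]
  generalize ζ ^ k = z at *
  have hW : z + z⁻¹ = ((2 * z.re : ℝ) : ℂ) := by
    rw [Complex.inv_eq_conj hnorm, Complex.add_conj]
  have h1 : ((e : ℂ) * ((o : ℂ) / e * z) + o) ^ n * (((o : ℂ) / e * z)⁻¹) ^ (n / 2) =
      (((e * o : ℝ) * (2 + 2 * z.re)) ^ (n / 2) : ℝ) * (o * (1 + z)) ^ (n % 2) := by
    have h2 : (e : ℂ) * ((o : ℂ) / e * z) + o = o * (1 + z) := by field_simp; ring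
    have h3 : ((o : ℂ) * (1 + z)) ^ 2 * ((o : ℂ) / e * z)⁻¹ = e * o * (2 + (z + z⁻¹)) := by
      field_simp; ring
    rw [h2]
    nth_rewrite 1 [← Nat.div_add_mod n 2]
    rw [pow_add, pow_mul, mul_right_comm, ← mul_pow, h3, hW]
    push_cast
    ring
  rw [h1, Complex.re_ofReal_mul]
  congr 1
  rcases Nat.mod_two_eq_zero_or_one n with h | h <;> simp [h]

end Averages

/-! ### Averages of polynomials in `z + z⁻¹` -/

section Moments

variable {N : ℕ} {ζ : ℂ}

theorem pow_add_inv_pow_eq (hζ : IsPrimitiveRoot ζ N) (hN : N ≠ 0) (k : ℕ) :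
    ζ ^ k + (ζ ^ k)⁻¹ = ((2 * (ζ ^ k).re : ℝ) : ℂ) := by
  have h : ‖ζ ^ k‖ = 1 := by rw [norm_pow, hζ.norm'_eq_one hN, one_pow]
  rw [Complex.inv_eq_conj h, Complex.add_conj]

theorem abs_re_pow_le_one (hζ : IsPrimitiveRoot ζ N) (hN : N ≠ 0) (k : ℕ) :
    |(ζ ^ k).re| ≤ 1 := by
  have h : ‖ζ ^ k‖ = 1 := by rw [norm_pow, hζ.norm'_eq_one hN, one_pow]
  exact h ▸ Complex.abs_re_le_norm _

theorem sum_pow_two_mul_re (hζ : IsPrimitiveRoot ζ N) {j : ℕ} (hj : j < N) :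
    ∑ k ∈ Finset.range N, (2 * (ζ ^ k).re) ^ j =
      if Even j then (N : ℝ) * (j / 2).centralBinom else 0 := by
  have hN : N ≠ 0 := by omega
  have hζ0 : ζ ≠ 0 := hζ.ne_zero hN
  have h1 (k : ℕ) : (((2 * (ζ ^ k).re) ^ j : ℝ) : ℂ) =
      ∑ i ∈ Finset.range (j + 1), (j.choose i : ℂ) * (ζ ^ k) ^ (2 * i - j : ℤ) := by
    rw [Complex.ofReal_pow, ← pow_add_inv_pow_eq hζ hN, add_pow]
    refine Finset.sum_congr rfl fun i hi => ?_
    have hi' : i ≤ j := by have := Finset.mem_range.1 hi; omega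
    rw [mul_comm]
    congr 1
    rw [show (2 * i - j : ℤ) = i - (j - i : ℕ) by push_cast [hi']; ring,
      zpow_sub₀ (pow_ne_zero k hζ0), zpow_natCast, zpow_natCast, inv_pow, div_eq_mul_inv]
  have h2 : ((∑ k ∈ Finset.range N, (2 * (ζ ^ k).re) ^ j : ℝ) : ℂ) =
      ∑ i ∈ Finset.range (j + 1), (j.choose i : ℂ) * if (2 * i - j : ℤ) = 0 then (N : ℂ) else 0 := by
    rw [Complex.ofReal_sum, Finset.sum_congr rfl fun k _ => h1 k, Finset.sum_comm]
    refine Finset.sum_congr rfl fun i hi => ?_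
    have hi' : i ≤ j := by have := Finset.mem_range.1 hi; omega
    rw [← Finset.mul_sum, sum_zpow_pow hζ (by rw [abs_lt]; omega)]
  apply Complex.ofReal_injective
  rw [h2]
  split_ifs with he
  · obtain ⟨m, rfl⟩ := he
    rw [Finset.sum_eq_single m]
    · rw [if_pos (by push_cast; ring), show (m + m) / 2 = m by omega, Nat.centralBinom, two_mul]
      push_cast
      ring
    · intro i _ hi
      rw [if_neg (by push_cast; omega), mul_zero]
    · intro h
      exact absurd (Finset.mem_range.2 (by omega)) h
  · rw [Finset.sum_eq_zero, Complex.ofReal_zero]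
    intro i _
    rw [if_neg, mul_zero]
    intro h
    exact he ⟨i, by omega⟩

/-- Integration by parts on the circle: with `W = z + z⁻¹`, the functions `W p(W)` and
`(4 - W²) p'(W)` have the same average. -/
theorem sum_mul_eval_eq_sum_mul_eval_derivative (hζ : IsPrimitiveRoot ζ N) (p : Polynomial ℝ)
    (hp : p.natDegree + 1 < N) :
    ∑ k ∈ Finset.range N, (2 * (ζ ^ k).re) * p.eval (2 * (ζ ^ k).re) =
      ∑ k ∈ Finset.range N,
        (4 - (2 * (ζ ^ k).re) ^ 2) * p.derivative.eval (2 * (ζ ^ k).re) := by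
  refine Polynomial.induction_with_natDegree_le (fun p : Polynomial ℝ =>
    ∑ k ∈ Finset.range N, (2 * (ζ ^ k).re) * p.eval (2 * (ζ ^ k).re) =
      ∑ k ∈ Finset.range N, (4 - (2 * (ζ ^ k).re) ^ 2) * p.derivative.eval (2 * (ζ ^ k).re))
    p.natDegree (by simp) ?_ ?_ p le_rfl
  · intro j r _ hj
    have h (k : ℕ) : (4 - (2 * (ζ ^ k).re) ^ 2) *
        (Polynomial.derivative (Polynomial.C r * Polynomial.X ^ j)).eval (2 * (ζ ^ k).re) =
        r * j * (4 * (2 * (ζ ^ k).re) ^ (j - 1) - (2 * (ζ ^ k).re) ^ (j - 1 + 2)) := by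
      rw [Polynomial.derivative_C_mul_X_pow, Polynomial.eval_C_mul, Polynomial.eval_pow,
        Polynomial.eval_X]
      ring
    have h' (k : ℕ) : (2 * (ζ ^ k).re) *
        (Polynomial.C r * Polynomial.X ^ j).eval (2 * (ζ ^ k).re) =
        r * (2 * (ζ ^ k).re) ^ (j + 1) := by
      rw [Polynomial.eval_C_mul, Polynomial.eval_pow, Polynomial.eval_X]
      ring
    simp only [h, h', ← Finset.mul_sum, Finset.sum_sub_distrib]
    rcases Nat.eq_zero_or_pos j with rfl | hj0
    · rw [sum_pow_two_mul_re hζ (by omega)]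
      simp
    · rw [sum_pow_two_mul_re hζ (by omega), sum_pow_two_mul_re hζ (by omega),
        sum_pow_two_mul_re hζ (by omega)]
      rcases Nat.even_or_odd' j with ⟨i, rfl | rfl⟩
      · rw [if_neg (by simp), if_neg (by rw [Nat.not_even_iff]; omega),
          if_neg (by rw [Nat.not_even_iff]; omega)]
        simp
      · rw [if_pos ⟨i + 1, by ring⟩, if_pos ⟨i, by omega⟩, if_pos ⟨i + 1, by omega⟩,
          show (2 * i + 1 + 1) / 2 = i + 1 by omega, show (2 * i + 1 - 1) / 2 = i by omega,
          show (2 * i + 1 - 1 + 2) / 2 = i + 1 by omega]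
        have hb : ((i : ℝ) + 1) * (i + 1).centralBinom = 2 * (2 * i + 1) * i.centralBinom := by
          exact_mod_cast Nat.succ_mul_centralBinom_succ i
        push_cast
        linear_combination 2 * r * N * hb
  · intro f g _ _ hf hg
    simp only [Polynomial.eval_add, Polynomial.derivative_add, mul_add, Finset.sum_add_distrib,
      hf, hg]

/-- The derivative of this average is, after integration by parts, the average of a positive
function: this is how the surplus over the value at `r = 1` is seen, although at `r = 1` the
derivative vanishes and the comparison is not valid pointwise on the circle. -/
theorem strictMonoOn_sum_two_add_div (hζ : IsPrimitiveRoot ζ N) {m : ℕ} (hm : m ≠ 0)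
    (hmN : m + 1 < N) : StrictMonoOn (fun r : ℝ => ∑ k ∈ Finset.range N,
      (2 + 2 * (ζ ^ k).re / r) * (1 + r ^ 2 + 2 * (ζ ^ k).re / r) ^ m) (Set.Ici 1) := by
  have hN : N ≠ 0 := by omega
  obtain ⟨l, rfl⟩ : ∃ l, m = l + 1 := ⟨m - 1, by omega⟩
  have hderiv (r : ℝ) (hr : 1 ≤ r) : HasDerivAt (fun r : ℝ => ∑ k ∈ Finset.range N,
      (2 + 2 * (ζ ^ k).re / r) * (1 + r ^ 2 + 2 * (ζ ^ k).re / r) ^ (l + 1))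
      (∑ k ∈ Finset.range N, (-(2 * (ζ ^ k).re) / r ^ 2 *
        (1 + r ^ 2 + 2 * (ζ ^ k).re / r) ^ (l + 1) + (2 + 2 * (ζ ^ k).re / r) *
        ((l + 1) * (1 + r ^ 2 + 2 * (ζ ^ k).re / r) ^ l *
          (2 * r + -(2 * (ζ ^ k).re) / r ^ 2)))) r := by
    refine HasDerivAt.fun_sum fun k _ => ?_
    have hr0 : r ≠ 0 := by linarith
    have h1 : HasDerivAt (fun r : ℝ => 2 * (ζ ^ k).re / r) (-(2 * (ζ ^ k).re) / r ^ 2) r := by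
      have := (hasDerivAt_inv hr0).const_mul (2 * (ζ ^ k).re)
      simp only [← div_eq_mul_inv] at this
      exact this.congr_deriv (by ring)
    have h2 : HasDerivAt (fun r : ℝ => 1 + r ^ 2 + 2 * (ζ ^ k).re / r)
        (2 * r + -(2 * (ζ ^ k).re) / r ^ 2) r := by
      exact (((hasDerivAt_pow 2 r).const_add 1).add h1).congr_deriv (by norm_num)
    exact ((h1.const_add 2).mul (h2.pow (l + 1))).congr_deriv
      (by simp only [Nat.add_sub_cancel]; push_cast; rfl)
  refine strictMonoOn_of_deriv_pos (convex_Ici 1)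
    (fun r hr => (hderiv r hr).continuousAt.continuousWithinAt) fun r hr => ?_
  rw [interior_Ici, Set.mem_Ioi] at hr
  rw [(hderiv r hr.le).deriv]
  have hr0 : 0 < r := by linarith
  have hparts := sum_mul_eval_eq_sum_mul_eval_derivative hζ
    ((Polynomial.C (1 + r ^ 2) + Polynomial.C (1 / r) * Polynomial.X) ^ (l + 1)) (by
      refine lt_of_le_of_lt (Nat.succ_le_succ (Polynomial.natDegree_pow_le_of_le (l + 1)
        (Polynomial.natDegree_add_le_of_degree_le (n := 1)
          ((Polynomial.natDegree_C _).trans_le (Nat.zero_le 1))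
          (Polynomial.natDegree_C_mul_le _ _ |>.trans (by simp))))) (by omega))
  simp only [Polynomial.derivative_pow, Polynomial.derivative_add, Polynomial.derivative_C,
    Polynomial.derivative_C_mul, Polynomial.derivative_X, Polynomial.eval_mul,
    Polynomial.eval_pow, Polynomial.eval_add, Polynomial.eval_C, Polynomial.eval_X, zero_add,
    mul_one, Nat.add_sub_cancel] at hparts
  have hrw : ∑ k ∈ Finset.range N, (-(2 * (ζ ^ k).re) / r ^ 2 *
        (1 + r ^ 2 + 2 * (ζ ^ k).re / r) ^ (l + 1) + (2 + 2 * (ζ ^ k).re / r) *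
        ((l + 1) * (1 + r ^ 2 + 2 * (ζ ^ k).re / r) ^ l *
          (2 * r + -(2 * (ζ ^ k).re) / r ^ 2))) =
      ∑ k ∈ Finset.range N, (l + 1) * (1 - 1 / r ^ 2) *
        (4 * (r ^ 2 + 1) / r + 2 * (2 * (ζ ^ k).re)) * (1 + r ^ 2 + 2 * (ζ ^ k).re / r) ^ l := by
    have e1 : ∑ k ∈ Finset.range N, (-(2 * (ζ ^ k).re) / r ^ 2 *
        (1 + r ^ 2 + 2 * (ζ ^ k).re / r) ^ (l + 1)) = -1 / r ^ 2 *
        ∑ k ∈ Finset.range N, 2 * (ζ ^ k).re * (1 + r ^ 2 + 1 / r * (2 * (ζ ^ k).re)) ^ (l + 1) := by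
      rw [Finset.mul_sum]
      refine Finset.sum_congr rfl fun k _ => ?_
      rw [one_div_mul_eq_div]
      ring
    rw [Finset.sum_add_distrib, e1, hparts, Finset.mul_sum, ← Finset.sum_add_distrib]
    refine Finset.sum_congr rfl fun k _ => ?_
    rw [one_div_mul_eq_div]
    generalize (1 + r ^ 2 + 2 * (ζ ^ k).re / r) ^ l = q
    push_cast
    field_simp
    ring
  rw [hrw]
  refine Finset.sum_pos (fun k _ => ?_) ⟨0, Finset.mem_range.2 (by omega)⟩
  obtain ⟨hx1, hx2⟩ := abs_le.1 (abs_re_pow_le_one hζ hN k)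
  have hq : 0 < 1 + r ^ 2 + 2 * (ζ ^ k).re / r := by
    have : 1 + r ^ 2 + 2 * (ζ ^ k).re / r = (r * (1 + r ^ 2) + 2 * (ζ ^ k).re) / r := by
      field_simp
    rw [this]
    apply div_pos _ hr0
    nlinarith [mul_pos hr0 (sub_pos.2 hr)]
  have h1 : 0 < 1 - 1 / r ^ 2 := by
    rw [sub_pos, div_lt_one (by positivity)]
    nlinarith
  have h2 : 0 < 4 * (r ^ 2 + 1) / r + 2 * (2 * (ζ ^ k).re) := by
    have : 4 * (r ^ 2 + 1) / r + 2 * (2 * (ζ ^ k).re) =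
        4 * (r ^ 2 + 1 + (ζ ^ k).re * r) / r := by
      field_simp
      ring
    rw [this]
    apply div_pos _ hr0
    nlinarith [mul_nonneg hr0.le (by linarith : 0 ≤ (ζ ^ k).re + 1)]
  positivity

end Moments

/-! ### Comparison of the node counts -/

section Comparison

variable {n d k N : ℕ} {ζ : ℂ}

theorem card_foldCrit_of_odd (hk : k ≠ 0) (hd : d = 2 * k + 1) :
    (foldCrit d 0).card = k * (2 * k + 1) ∧ (foldCrit d 1).card + k = k * k ∧
      (foldCrit d (-1)).card = k * k := by
  obtain ⟨k, rfl⟩ := Nat.exists_eq_succ_of_ne_zero hk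
  have h0 := card_foldCrit_zero (d := d) (by omega)
  have h1 := card_foldCrit_one d
  have h2 := card_foldCrit_neg_one d
  rw [show d / 2 = k + 1 by omega, show (d - 1) / 2 = k + 1 by omega] at h1 h2
  rw [show d - 1 = 2 * (k + 1) by omega] at h0
  rw [Nat.add_sub_cancel] at h1
  subst hd
  simp only [Nat.succ_eq_add_one] at *
  exact ⟨by linarith, by linarith, h2⟩

theorem card_foldCrit_of_even (hk : k ≠ 0) (hd : d = 2 * k + 2) :
    (foldCrit d 0).card = (k + 1) * (2 * k + 1) ∧ (foldCrit d 1).card = k * k ∧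
      (foldCrit d (-1)).card = k * (k + 1) := by
  obtain ⟨k, rfl⟩ := Nat.exists_eq_succ_of_ne_zero hk
  have h0 := card_foldCrit_zero (d := d) (by omega)
  have h1 := card_foldCrit_one d
  have h2 := card_foldCrit_neg_one d
  rw [show d / 2 = k + 2 by omega, show (d - 1) / 2 = k + 1 by omega] at h1 h2
  rw [show d - 1 = 2 * k + 3 by omega, show d = 2 * k + 4 by omega] at h0
  rw [Nat.add_sub_cancel, show k + 2 - 1 = k + 1 by omega] at h1
  rw [show d = 2 * k + 4 by omega] at *
  simp only [Nat.succ_eq_add_one] at *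
  exact ⟨by linarith, by linarith, by linarith⟩

theorem abs_re_lt_one (hζ : IsPrimitiveRoot ζ N) (hN : 2 < N) : |ζ.re| < 1 := by
  have h1 : ‖ζ‖ = 1 := hζ.norm'_eq_one (by omega)
  rw [← h1]
  refine lt_of_le_of_ne (Complex.abs_re_le_norm _) fun h => ?_
  rw [Complex.abs_re_eq_norm] at h
  have h2 : ζ ^ 2 = 1 := by
    have h3 := Complex.sq_norm ζ
    rw [h1, Complex.normSq_apply, h] at h3
    apply Complex.ext
    · simp [pow_two, h]; linarith
    · simp [pow_two, h]
  have := Nat.le_of_dvd two_pos (hζ.dvd_of_pow_eq_one 2 h2)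
  omega

/-- For even `d`, the two critical values of `T_d` have unequal multiplicities `k + 1` and `k`; on
the circle of radius `r = √((k + 1) / k)` the generating polynomial of `F_d` becomes real. -/
theorem nodeCount_tchm_lt_chmB2Plain (hn : 2 ≤ n) (hd : 3 ≤ d) (hd2 : Even d) :
    nodeCount (tchm n d) < nodeCount (chmB2Plain n d) := by
  obtain ⟨j, rfl⟩ := hd2
  obtain ⟨k, rfl⟩ : ∃ k, j = k + 1 := ⟨j - 1, by omega⟩
  obtain ⟨c0, c1, c2⟩ := card_foldCrit_of_even (k := k) (d := k + 1 + (k + 1)) (by omega) (by omega)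
  -- The order `n + 2` exceeds the absolute values of all exponents in the generating functions.
  have hζ := Complex.isPrimitiveRoot_exp (n + 2) (by omega)
  generalize Complex.exp (2 * Real.pi * Complex.I / (n + 2 : ℕ)) = ζ at hζ
  have hk : (0 : ℝ) < k := by exact_mod_cast (by omega : 0 < k)
  set r : ℝ := √((k + 1) / k) with hr
  have hr2 : r ^ 2 = (k + 1) / k := Real.sq_sqrt (by positivity)
  have hrpos : 0 < r := Real.sqrt_pos.2 (by positivity)
  have hkr : k * r ^ 2 = k + 1 := by rw [hr2]; field_simp
  have hr1 : 1 < r := lt_of_pow_lt_pow_left₀ 2 hrpos.le (by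
    rw [hr2, one_pow, one_lt_div hk]
    linarith)
  have hT := natCast_mul_nodeCount_tchm_le_sum (n := n) hd (N := n + 2) (by omega) hζ
  have hF := le_natCast_mul_nodeCount_chmB2 (n := n) (d := k + 1 + (k + 1)) (ε := fun _ => 1)
    (by simp) (by omega) (N := n + 2) (by omega) hζ (ρ := r) (by exact_mod_cast hrpos.ne')
  rw [show (k + 1 + (k + 1) - 1) / 2 = k by omega, show (k + 1 + (k + 1)) / 2 = k + 1 by omega]
    at hT hF
  rw [c0, c1, c2, Complex.re_sum] at hF
  have hterm (i : ℕ) : ((∏ _j ∈ Finset.range (n / 2), ((((k + 1) * (2 * k + 1) : ℕ) : ℂ) +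
      ((k * k : ℕ) : ℂ) * (r * ζ ^ i) ^ (1 : ℤ) +
      ((k * (k + 1) : ℕ) : ℂ) * ((r * ζ ^ i) ^ (1 : ℤ))⁻¹)) *
      ((k : ℂ) * (r * ζ ^ i) + (k + 1 : ℕ)) ^ (n % 2)).re =
      ((k * (k + 1 : ℕ) : ℝ) * (1 + r ^ 2 + 2 * (ζ ^ i).re / r)) ^ (n / 2) *
        (((k + 1 : ℕ) : ℝ) * (1 + (ζ ^ i).re / r)) ^ (n % 2) := by
    have hW := pow_add_inv_pow_eq hζ (by omega) i
    have hz0 : ζ ^ i ≠ 0 := pow_ne_zero _ (hζ.ne_zero (by omega))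
    have hrc : (r : ℂ) ≠ 0 := by exact_mod_cast hrpos.ne'
    have hkrc : (k : ℂ) * r ^ 2 = k + 1 := by exact_mod_cast hkr
    generalize ζ ^ i = z at *
    have h1 : (((k + 1) * (2 * k + 1) : ℕ) : ℂ) + ((k * k : ℕ) : ℂ) * (r * z) ^ (1 : ℤ) +
        ((k * (k + 1) : ℕ) : ℂ) * ((r * z) ^ (1 : ℤ))⁻¹ =
        (((k * (k + 1 : ℕ) : ℝ) * (1 + r ^ 2 + 2 * z.re / r) : ℝ) : ℂ) := by
      have h2 : (k : ℂ) * r = (k + 1) * (r : ℂ)⁻¹ := by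
        field_simp
        linear_combination hkrc
      have h3 : (((k * (k + 1 : ℕ) : ℝ) * (1 + r ^ 2 + 2 * z.re / r) : ℝ) : ℂ) =
          k * (k + 1) * (1 + r ^ 2 + (z + z⁻¹) * (r : ℂ)⁻¹) := by
        rw [hW]
        push_cast
        ring
      rw [h3, zpow_one, mul_inv]
      push_cast
      linear_combination k * z * h2 - (k + 1) * hkrc
    have h4 : (k : ℂ) * (r * z) + (k + 1 : ℕ) = (((k + 1 : ℕ) : ℝ) : ℂ) * (1 + z / r) := by
      push_cast
      field_simp
      linear_combination z * hkrc
    rw [Finset.prod_const, Finset.card_range, h1, h4, ← Complex.ofReal_pow, Complex.re_ofReal_mul]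
    congr 1
    rcases Nat.mod_two_eq_zero_or_one n with h | h <;> rw [h]
    · simp
    · rw [pow_one, pow_one, Complex.re_ofReal_mul, Complex.add_re, Complex.div_ofReal_re,
        Complex.one_re]
  rw [Finset.sum_congr rfl fun i _ => hterm i] at hF
  have hmain : ∑ i ∈ Finset.range (n + 2), ((k * (k + 1 : ℕ) : ℝ) * (2 + 2 * (ζ ^ i).re)) ^ (n / 2) *
        (((k + 1 : ℕ) : ℝ) * (1 + (ζ ^ i).re)) ^ (n % 2) <
      ∑ i ∈ Finset.range (n + 2),
        ((k * (k + 1 : ℕ) : ℝ) * (1 + r ^ 2 + 2 * (ζ ^ i).re / r)) ^ (n / 2) *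
        (((k + 1 : ℕ) : ℝ) * (1 + (ζ ^ i).re / r)) ^ (n % 2) := by
    have hc : 0 < (k * (k + 1 : ℕ) : ℝ) := by positivity
    rcases Nat.mod_two_eq_zero_or_one n with h | h <;> rw [h]
    · simp only [pow_zero, mul_one]
      refine Finset.sum_lt_sum_of_nonempty ⟨0, Finset.mem_range.2 (by omega)⟩ fun i _ => ?_
      obtain ⟨hx1, hx2⟩ := abs_le.1 (abs_re_pow_le_one hζ (by omega) i)
      refine pow_lt_pow_left₀ (mul_lt_mul_of_pos_left ?_ hc) (mul_nonneg hc.le (by linarith))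
        (by omega)
      have h5 : 1 + r ^ 2 + 2 * (ζ ^ i).re / r - (2 + 2 * (ζ ^ i).re) =
          (r - 1) * (r * (r + 1) - 2 * (ζ ^ i).re) / r := by
        field_simp
        ring
      rw [← sub_pos, h5]
      apply div_pos _ hrpos
      apply mul_pos <;> nlinarith
    · have hmono := strictMonoOn_sum_two_add_div hζ (m := n / 2) (by omega) (by omega)
        (Set.mem_Ici.2 le_rfl) (Set.mem_Ici.2 hr1.le) hr1
      have hfac (t : ℝ) (a b : ℕ → ℝ) (hab : ∀ i, b i = 2 * a i) :
          ∑ i ∈ Finset.range (n + 2), ((k * (k + 1 : ℕ) : ℝ) * (t + b i)) ^ (n / 2) *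
            (((k + 1 : ℕ) : ℝ) * (1 + a i)) ^ 1 =
          (k * (k + 1 : ℕ) : ℝ) ^ (n / 2) * (((k + 1 : ℕ) : ℝ) / 2) *
            ∑ i ∈ Finset.range (n + 2), (2 + b i) * (t + b i) ^ (n / 2) := by
        rw [Finset.mul_sum]
        refine Finset.sum_congr rfl fun i _ => ?_
        rw [hab, mul_pow]
        ring
      rw [hfac 2 _ (fun i => 2 * (ζ ^ i).re) fun i => rfl,
        hfac (1 + r ^ 2) (fun i => (ζ ^ i).re / r) (fun i => 2 * (ζ ^ i).re / r)
          fun i => mul_div_assoc _ _ _]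
      refine mul_lt_mul_of_pos_left ?_ (by positivity)
      norm_num at hmono
      exact hmono
  have hlt := (hT.trans_lt hmain).trans_le hF
  exact_mod_cast lt_of_mul_lt_mul_left hlt (by positivity)

theorem prod_alternating_conj (q : ℂ) (m : ℕ) :
    ∏ i ∈ Finset.range m, (if Even i then q else (starRingEnd ℂ) q) =
      ((Complex.normSq q ^ (m / 2) : ℝ) : ℂ) * q ^ (m % 2) := by
  have heven (l : ℕ) : ∏ i ∈ Finset.range (2 * l), (if Even i then q else (starRingEnd ℂ) q) =
      ((Complex.normSq q ^ l : ℝ) : ℂ) := by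
    induction l with
    | zero => simp
    | succ l ih =>
      rw [mul_add, mul_one, Finset.prod_range_succ, Finset.prod_range_succ, ih, if_pos (by simp),
        if_neg (by simp), mul_assoc, Complex.mul_conj, pow_succ, Complex.ofReal_mul]
  rcases Nat.even_or_odd' m with ⟨l, rfl | rfl⟩
  · rw [heven, show 2 * l / 2 = l by omega, show 2 * l % 2 = 0 by omega, pow_zero, mul_one]
  · rw [Finset.prod_range_succ, heven, if_pos (by simp), show (2 * l + 1) / 2 = l by omega,
      show (2 * l + 1) % 2 = 1 by omega, pow_one]

/-- With alternating signs the factors of the generating function pair up to `|q|²`, which is at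
least `(re q)²`; here `w` is the factor of an unpaired last coordinate. -/
theorem le_re_prod_alternating_mul {q w : ℂ} {a : ℝ} (hq : 0 ≤ q.re) (ha : 0 ≤ a)
    (hw : a ≤ w.re) (hqw : q.re * a ≤ (q * w).re) (m : ℕ) :
    q.re ^ m * a ≤ ((∏ i ∈ Finset.range m, (if Even i then q else (starRingEnd ℂ) q)) * w).re := by
  have h1 : (q.re ^ 2) ^ (m / 2) ≤ Complex.normSq q ^ (m / 2) := by
    refine pow_le_pow_left₀ (sq_nonneg _) ?_ _
    rw [Complex.normSq_apply]
    nlinarith [mul_self_nonneg q.im]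
  rw [prod_alternating_conj, mul_assoc, Complex.re_ofReal_mul]
  nth_rewrite 1 [← Nat.div_add_mod m 2]
  rw [pow_add, pow_mul, mul_assoc]
  refine mul_le_mul h1 ?_ (mul_nonneg (pow_nonneg hq _) ha)
    (pow_nonneg (Complex.normSq_nonneg _) _)
  rcases Nat.mod_two_eq_zero_or_one m with h | h <;> rw [h]
  · simpa using hw
  · simpa using hqw

theorem nodeCount_tchm_lt_chmB2Alt (hn : 2 ≤ n) (hd : 3 ≤ d) (h : Even n ∨ Odd d) :
    nodeCount (tchm n d) < nodeCount (chmB2Alt n d) := by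
  -- The order `n + 2` exceeds the absolute values of all exponents in the generating functions.
  have hζ := Complex.isPrimitiveRoot_exp (n + 2) (by omega)
  generalize Complex.exp (2 * Real.pi * Complex.I / (n + 2 : ℕ)) = ζ at hζ
  have hT := natCast_mul_nodeCount_tchm_le_sum (n := n) hd (N := n + 2) (by omega) hζ
  have hF := le_natCast_mul_nodeCount_chmB2 (n := n) (d := d) (ε := fun i => (-1) ^ i)
    (by simp) (by omega) (N := n + 2) (by omega) hζ one_ne_zero
  set e := (d - 1) / 2 with he
  set o := d / 2 with ho
  set q : ℂ → ℂ := fun z => (foldCrit d 0).card + (foldCrit d 1).card * z +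
    (foldCrit d (-1)).card * z⁻¹ with hq
  have hfactor (j i : ℕ) : (((foldCrit d 0).card : ℂ) +
      (foldCrit d 1).card * (1 * ζ ^ j) ^ ((-1 : ℤ) ^ i) +
      (foldCrit d (-1)).card * ((1 * ζ ^ j) ^ ((-1 : ℤ) ^ i))⁻¹) =
      if Even i then q (ζ ^ j) else (starRingEnd ℂ) (q (ζ ^ j)) := by
    have hnorm : ‖ζ ^ j‖ = 1 := by rw [norm_pow, hζ.norm'_eq_one (by omega), one_pow]
    rw [one_mul]
    split_ifs with hi
    · rw [hi.neg_one_pow, zpow_one]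
    · rw [(Nat.not_even_iff_odd.1 hi).neg_one_pow, zpow_neg_one, hq]
      simp only [map_add, map_mul, map_inv₀, Complex.conj_natCast, ← Complex.inv_eq_conj hnorm]
  simp only [hfactor] at hF
  simp only [one_mul, Complex.re_sum] at hF
  -- The real part of the generating polynomial exceeds the contribution to `TChm`.
  have hre (z : ℂ) (hz : ‖z‖ = 1) (hx : |z.re| ≤ 1) : 0 ≤ (e * o : ℝ) * (2 + 2 * z.re) ∧
      (e * o : ℝ) * (2 + 2 * z.re) + (1 - z.re) ≤ (q z).re := by
    obtain ⟨hx1, hx2⟩ := abs_le.1 hx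
    refine ⟨mul_nonneg (by positivity) (by linarith), ?_⟩
    have hqre : (q z).re = (foldCrit d 0).card +
        ((foldCrit d 1).card + (foldCrit d (-1)).card) * z.re := by
      simp only [hq, Complex.inv_eq_conj hz, Complex.add_re, ← Complex.ofReal_natCast,
        Complex.re_ofReal_mul, Complex.ofReal_re, Complex.conj_re]
      ring
    rw [hqre]
    rcases Nat.even_or_odd' d with ⟨k, hk | hk⟩
    · obtain ⟨k, rfl⟩ : ∃ l, k = l + 1 := ⟨k - 1, by omega⟩
      obtain ⟨c0, c1, c2⟩ := card_foldCrit_of_even (k := k) (d := d) (by omega) (by omega)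
      have hk1 : (1 : ℝ) ≤ k := by exact_mod_cast (by omega : 1 ≤ k)
      rw [c0, c1, c2, show e = k by omega, show o = k + 1 by omega]
      push_cast
      nlinarith
    · obtain ⟨c0, c1, c2⟩ := card_foldCrit_of_odd (k := k) (d := d) (by omega) (by omega)
      have c1' : ((foldCrit d 1).card : ℝ) = k * k - k := by
        rw [eq_sub_iff_add_eq]; exact_mod_cast c1
      have hk1 : (1 : ℝ) ≤ k := by exact_mod_cast (by omega : 1 ≤ k)
      rw [c0, c1', c2, show e = k by omega, show o = k by omega]
      push_cast
      nlinarith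
  have hlast (z : ℂ) (hz : ‖z‖ = 1) (hx : |z.re| ≤ 1) :
      0 ≤ ((o : ℝ) * (1 + z.re)) ^ (n % 2) ∧
      ((o : ℝ) * (1 + z.re)) ^ (n % 2) ≤ (((e : ℂ) * z + o) ^ (n % 2)).re ∧
      (q z).re * ((o : ℝ) * (1 + z.re)) ^ (n % 2) ≤ (q z * ((e : ℂ) * z + o) ^ (n % 2)).re := by
    obtain ⟨hx1, hx2⟩ := abs_le.1 hx
    rcases Nat.mod_two_eq_zero_or_one n with hn2 | hn2 <;> rw [hn2]
    · simp
    · obtain ⟨k, hk⟩ : Odd d := h.resolve_left (by rw [Nat.even_iff]; omega)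
      obtain ⟨c0, c1, c2⟩ := card_foldCrit_of_odd (k := k) (d := d) (by omega) (by omega)
      have c1' : ((foldCrit d 1).card : ℝ) = k * k - k := by
        rw [eq_sub_iff_add_eq]; exact_mod_cast c1
      have hqim : (q z).im = - k * z.im := by
        have : (q z).im = ((foldCrit d 1).card - (foldCrit d (-1)).card) * z.im := by
          simp only [hq, Complex.inv_eq_conj hz, Complex.add_im, ← Complex.ofReal_natCast,
            Complex.im_ofReal_mul, Complex.ofReal_im, Complex.conj_im]
          ring
        rw [this, c1', c2]
        push_cast
        ring
      have hw : ((e : ℂ) * z + o).re = o * (1 + z.re) ∧ ((e : ℂ) * z + o).im = k * z.im := by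
        rw [show e = k by omega, show o = k by omega]
        simp only [Complex.add_re, Complex.add_im, ← Complex.ofReal_natCast,
          Complex.re_ofReal_mul, Complex.im_ofReal_mul, Complex.ofReal_re, Complex.ofReal_im]
        constructor <;> ring
      simp only [pow_one]
      refine ⟨mul_nonneg (by positivity) (by linarith), hw.1.ge, ?_⟩
      rw [Complex.mul_re, hw.1, hw.2, hqim]
      nlinarith [mul_self_nonneg (k * z.im)]
  have hmain : ∑ i ∈ Finset.range (n + 2), ((e * o : ℝ) * (2 + 2 * (ζ ^ i).re)) ^ (n / 2) *
        ((o : ℝ) * (1 + (ζ ^ i).re)) ^ (n % 2) <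
      ∑ j ∈ Finset.range (n + 2), ((∏ i ∈ Finset.range (n / 2),
        if Even i then q (ζ ^ j) else (starRingEnd ℂ) (q (ζ ^ j))) *
        ((e : ℂ) * ζ ^ j + o) ^ (n % 2)).re := by
    -- Strictness may fail at `z = 1` and `z = -1`, but not at the primitive root `ζ`.
    refine Finset.sum_lt_sum (fun j _ => ?_) ⟨1, Finset.mem_range.2 (by omega), ?_⟩
    · have hz : ‖ζ ^ j‖ = 1 := by rw [norm_pow, hζ.norm'_eq_one (by omega), one_pow]
      have hx := abs_re_pow_le_one hζ (by omega) j
      obtain ⟨h0, h1⟩ := hre _ hz hx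
      obtain ⟨l0, l1, l2⟩ := hlast _ hz hx
      have h2 := (abs_le.1 hx).2
      refine le_trans ?_ (le_re_prod_alternating_mul (by linarith) l0 l1 l2 _)
      exact mul_le_mul_of_nonneg_right (pow_le_pow_left₀ h0 (by linarith) _) l0
    · have hz : ‖ζ ^ 1‖ = 1 := by rw [norm_pow, hζ.norm'_eq_one (by omega), one_pow]
      have hx := abs_re_pow_le_one hζ (by omega) 1
      obtain ⟨h0, h1⟩ := hre _ hz hx
      obtain ⟨l0, l1, l2⟩ := hlast _ hz hx
      have h2 := abs_lt.1 (abs_re_lt_one hζ (by omega))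
      rw [← pow_one ζ] at h2
      refine lt_of_lt_of_le ?_ (le_re_prod_alternating_mul (by linarith) l0 l1 l2 _)
      refine mul_lt_mul_of_pos_right (pow_lt_pow_left₀ (by linarith) h0 (by omega)) ?_
      have : 0 < o := by omega
      have h3 : 0 < 1 + (ζ ^ 1).re := by linarith
      positivity
  have hlt := (hT.trans_lt hmain).trans_le hF
  exact_mod_cast lt_of_mul_lt_mul_left hlt (by positivity)

end Comparison

end NodalHypersurface

open NodalHypersurface in
theorem mainTheorem7 (n d : ℕ) (hn : 2 ≤ n) (hd : 3 ≤ d) :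
    ((nodes (tchm n d)).Finite ∧ (nodes (chmB2Alt n d)).Finite ∧
      (nodes (chmB2Plain n d)).Finite) ∧
    nodeCount (tchm n d) < max (nodeCount (chmB2Alt n d)) (nodeCount (chmB2Plain n d)) ∧
    ((Even n ∨ Odd d) → nodeCount (tchm n d) < nodeCount (chmB2Alt n d)) ∧
    (Even d → nodeCount (tchm n d) < nodeCount (chmB2Plain n d)) := by
  refine ⟨⟨finite_nodes_tchm (by omega), finite_nodes_chmB2 (fun i => by simp) (by omega),
    finite_nodes_chmB2 (fun i => one_ne_zero) (by omega)⟩, ?_, nodeCount_tchm_lt_chmB2Alt hn hd,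
    nodeCount_tchm_lt_chmB2Plain hn hd⟩
  rcases Nat.even_or_odd d with h | h
  · exact lt_max_of_lt_right (nodeCount_tchm_lt_chmB2Plain hn hd h)
  · exact lt_max_of_lt_left (nodeCount_tchm_lt_chmB2Alt hn hd (Or.inr h))
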